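/- Let $a<b<c<d$ be real numbers and put $I_-=(-\infty,a)$, $I_0=(b,c)$, $I_+=(d,\infty)$, $\Omega=I_-\cup I_0\cup I_+$. Let $B\in U(2)$ be a unitary $2\times 2$ matrix, and let $P_B=\frac{1}{2\pi i}\frac{d}{dx}$ be the selfadjoint momentum operator in $L^2(\Omega)$ whose domain consists of all $f\in L^2(\Omega)$ that are absolutely continuous on (compact subintervals of the closures of) the three components, have $f'\in L^2(\Omega)$, and satisfy the boundary condition $$B\begin{pmatrix} f(b)\\ f(d)\end{pmatrix}=\begin{pmatrix} f(a)\\ f(c)\end{pmatrix},$$ where the boundary values are one-sided limits from within $\Omega$. Fix $\kappa>0$ and let $U_B(t)=e^{-i\kappa tP_B}$, $t\in\mathbb{R}$, be the strongly continuous unitary one-parameter group in $L^2(\Omega)$ with infinitesimal generator $-i\kappa P_B$; it exists and is unique. Let $P_0f=\chi_{I_0}f$ be the orthogonal projection of $L^2(\Omega)$ onto $L^2(I_0)=\{f\in L^2(\Omega):\chi_{I_0}f=f\}$. Then the compression $Z_B(t)=P_0U_B(t)P_0:L^2(I_0)\to L^2(I_0)$, $t\ge 0$ (the Lax–Phillips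 semigroup), is a strongly continuous contraction semigroup: $\|Z_B(t)\|\le 1$ for all $t\ge0$; $Z_B(t)Z_B(s)=Z_B(t+s)$ for all $s,t\ge 0$; $Z_B(0)=P_0$, which acts as the identity operator on $L^2(I_0)$; and $t\mapsto Z_B(t)f$ is continuous on $[0,\infty)$ for every $f\in L^2(I_0)$. -/

import Mathlib

open MeasureTheory Set Filter Topology
open scoped NNReal ENNReal Matrix

noncomputable section

namespace LaxPhillips

/-- End points `a < b < c < d` of the two obstacles `[a, b]` and `[c, d]` removed from the line. -/
structure Obstacles where
  a : ℝ
  b : ℝ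
  c : ℝ
  d : ℝ
  hab : a < b
  hbc : b < c
  hcd : c < d

namespace Obstacles

variable (G : Obstacles)

/-- The bounded component `I₀ = (b, c)`. -/
def I0 : Set ℝ := Ioo G.b G.c

/-- The exterior domain `Ω = (-∞, a) ∪ (b, c) ∪ (d, ∞)`. -/
def Omega : Set ℝ := Iio G.a ∪ G.I0 ∪ Ioi G.d

/-- The Hilbert space `L²(Ω)` of complex functions, for Lebesgue measure on `Ω`. -/
abbrev L2 : Type := Lp ℂ 2 (volume.restrict G.Omega)

/-- `F` is absolutely continuous on every compact subinterval of the closure of each of the three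
components of `Ω`; in particular `F a`, `F b`, `F c`, `F d` are its one-sided boundary values. -/
structure IsAC (F : ℝ → ℂ) : Prop where
  left : ∀ x ≤ G.a, AbsolutelyContinuousOnInterval F x G.a
  middle : AbsolutelyContinuousOnInterval F G.b G.c
  right : ∀ x ≥ G.d, AbsolutelyContinuousOnInterval F G.d x

/-- `F` is the absolutely continuous representative of `f ∈ L²(Ω)`, and its almost everywhere
derivative is `h ∈ L²(Ω)`. -/
structure IsRep (f h : G.L2) (F : ℝ → ℂ) : Prop where
  ac : G.IsAC F
  ae_eq : f =ᵐ[volume.restrict G.Omega] F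
  hasDerivAt : ∀ᵐ x ∂(volume.restrict G.Omega), HasDerivAt F (h x) x

/-- The boundary condition `B ρ₁(F) = ρ₂(F)`, with `ρ₁(F) = (F(b), F(d))` the values at the left
end points of components of `Ω` and `ρ₂(F) = (F(a), F(c))` those at the right end points. -/
def BoundaryCondition (B : Matrix (Fin 2) (Fin 2) ℂ) (F : ℝ → ℂ) : Prop :=
  B *ᵥ ![F G.b, F G.d] = ![F G.a, F G.c]

variable {G}

theorem isOpen_Omega : IsOpen G.Omega :=
  (isOpen_Iio.union isOpen_Ioo).union isOpen_Ioi

theorem IsAC.continuousOn {F : ℝ → ℂ} (hF : G.IsAC F) : ContinuousOn F G.Omega := by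
  intro x hx
  refine ContinuousAt.continuousWithinAt ?_
  rcases hx with (hx | hx) | hx
  · have hx' : x < G.a := hx
    refine (hF.left (x - 1) (by linarith)).continuousOn.continuousAt ?_
    rw [uIcc_of_le (by linarith)]
    exact Icc_mem_nhds (by linarith) hx'
  · refine hF.middle.continuousOn.continuousAt ?_
    rw [uIcc_of_le G.hbc.le]
    exact Icc_mem_nhds hx.1 hx.2
  · have hx' : G.d < x := hx
    refine (hF.right (x + 1) (show G.d ≤ x + 1 by linarith)).continuousOn.continuousAt ?_
    rw [uIcc_of_le (by linarith)]
    exact Icc_mem_nhds hx' (by linarith)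

theorem IsRep.unique {f h₁ h₂ : G.L2} {F₁ F₂ : ℝ → ℂ}
    (H₁ : G.IsRep f h₁ F₁) (H₂ : G.IsRep f h₂ F₂) : h₁ = h₂ := by
  have hEq : EqOn F₁ F₂ G.Omega :=
    Measure.eqOn_open_of_ae_eq (H₁.ae_eq.symm.trans H₂.ae_eq) isOpen_Omega
      H₁.ac.continuousOn H₂.ac.continuousOn
  refine Lp.ext ?_
  filter_upwards [H₁.hasDerivAt, H₂.hasDerivAt,
    ae_restrict_mem isOpen_Omega.measurableSet] with x h1 h2 hx
  have : F₁ =ᶠ[𝓝 x] F₂ := hEq.eventuallyEq_of_mem (isOpen_Omega.mem_nhds hx)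
  exact h1.unique (h2.congr_of_eventuallyEq this)

theorem IsRep.add {f₁ f₂ h₁ h₂ : G.L2} {F₁ F₂ : ℝ → ℂ}
    (H₁ : G.IsRep f₁ h₁ F₁) (H₂ : G.IsRep f₂ h₂ F₂) :
    G.IsRep (f₁ + f₂) (h₁ + h₂) (F₁ + F₂) where
  ac := ⟨fun x hx => (H₁.ac.left x hx).add (H₂.ac.left x hx), H₁.ac.middle.add H₂.ac.middle,
    fun x hx => (H₁.ac.right x hx).add (H₂.ac.right x hx)⟩
  ae_eq := (Lp.coeFn_add f₁ f₂).trans (H₁.ae_eq.add H₂.ae_eq)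
  hasDerivAt := by
    filter_upwards [H₁.hasDerivAt, H₂.hasDerivAt, Lp.coeFn_add h₁ h₂] with x h1 h2 h3
    rw [h3]
    exact h1.add h2

theorem IsRep.smul {f h : G.L2} {F : ℝ → ℂ} (k : ℂ) (H : G.IsRep f h F) :
    G.IsRep (k • f) (k • h) (fun x => k • F x) where
  ac := ⟨fun x hx => (H.ac.left x hx).const_smul k, H.ac.middle.const_smul k,
    fun x hx => (H.ac.right x hx).const_smul k⟩
  ae_eq := by
    filter_upwards [Lp.coeFn_smul k f, H.ae_eq] with x h1 h2
    simp [h1, h2]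
  hasDerivAt := by
    filter_upwards [H.hasDerivAt, Lp.coeFn_smul k h] with x h1 h2
    rw [h2]
    exact h1.const_smul k

theorem IsRep.zero : G.IsRep 0 0 (fun _ => 0) where
  ac := by
    have h : ∀ x y : ℝ, AbsolutelyContinuousOnInterval (fun _ : ℝ => (0 : ℂ)) x y := by
      intro x y
      simpa [AbsolutelyContinuousOnInterval] using tendsto_const_nhds
    exact ⟨fun _ _ => h _ _, h _ _, fun _ _ => h _ _⟩
  ae_eq := Lp.coeFn_zero ℂ 2 _
  hasDerivAt := by
    filter_upwards [Lp.coeFn_zero ℂ 2 (volume.restrict G.Omega)] with x hx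
    rw [hx]
    exact hasDerivAt_const x 0

theorem BoundaryCondition.add {B : Matrix (Fin 2) (Fin 2) ℂ} {F₁ F₂ : ℝ → ℂ}
    (H₁ : G.BoundaryCondition B F₁) (H₂ : G.BoundaryCondition B F₂) :
    G.BoundaryCondition B (F₁ + F₂) := by
  unfold BoundaryCondition at *
  have e₁ : ![(F₁ + F₂) G.b, (F₁ + F₂) G.d] = ![F₁ G.b, F₁ G.d] + ![F₂ G.b, F₂ G.d] := by simp
  have e₂ : ![(F₁ + F₂) G.a, (F₁ + F₂) G.c] = ![F₁ G.a, F₁ G.c] + ![F₂ G.a, F₂ G.c] := by simp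
  rw [e₁, e₂, Matrix.mulVec_add, H₁, H₂]

theorem BoundaryCondition.smul {B : Matrix (Fin 2) (Fin 2) ℂ} {F : ℝ → ℂ} (k : ℂ)
    (H : G.BoundaryCondition B F) : G.BoundaryCondition B (fun x => k • F x) := by
  unfold BoundaryCondition at *
  have e₁ : ![k • F G.b, k • F G.d] = k • ![F G.b, F G.d] := by simp
  have e₂ : ![k • F G.a, k • F G.c] = k • ![F G.a, F G.c] := by simp
  rw [e₁, e₂, Matrix.mulVec_smul, H]

variable (G)

/-- The domain of `P_B`: all `f ∈ L²(Ω)` that have an absolutely continuous representative with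
derivative in `L²(Ω)` and satisfying the boundary condition given by `B`. -/
def momentumDomain (B : Matrix (Fin 2) (Fin 2) ℂ) : Submodule ℂ G.L2 where
  carrier := {f | ∃ h F, G.IsRep f h F ∧ G.BoundaryCondition B F}
  add_mem' := by
    rintro _ _ ⟨h₁, F₁, H₁, K₁⟩ ⟨h₂, F₂, H₂, K₂⟩
    exact ⟨_, _, H₁.add H₂, K₁.add K₂⟩
  zero_mem' := ⟨0, fun _ => 0, IsRep.zero, by simp [BoundaryCondition]⟩
  smul_mem' := by
    rintro k _ ⟨h, F, H, K⟩
    exact ⟨_, _, H.smul k, K.smul k⟩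

variable {G}

/-- The derivative `f' ∈ L²(Ω)` of an element `f` of the domain. -/
def derivOf {B : Matrix (Fin 2) (Fin 2) ℂ} (f : G.momentumDomain B) : G.L2 := f.2.choose

theorem derivOf_eq {B : Matrix (Fin 2) (Fin 2) ℂ} (f : G.momentumDomain B) {h : G.L2}
    {F : ℝ → ℂ} (H : G.IsRep f h F) : derivOf f = h := by
  obtain ⟨F', H', -⟩ := f.2.choose_spec
  exact IsRep.unique H' H

variable (G)

/-- The momentum operator `P_B = (1 / 2πi) d/dx` in `L²(Ω)` with the boundary condition given
by `B`. -/
def momentum (B : Matrix (Fin 2) (Fin 2) ℂ) : G.L2 →ₗ.[ℂ] G.L2 where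
  domain := G.momentumDomain B
  toFun :=
    { toFun := fun f => (1 / (2 * Real.pi * Complex.I) : ℂ) • derivOf f
      map_add' := by
        intro f g
        obtain ⟨F, H, -⟩ := f.2.choose_spec
        obtain ⟨F', H', -⟩ := g.2.choose_spec
        rw [derivOf_eq (f + g) (H.add H'), smul_add]
        rfl
      map_smul' := by
        intro k f
        obtain ⟨F, H, -⟩ := f.2.choose_spec
        rw [derivOf_eq (k • f) (H.smul k), smul_comm]
        rfl }

theorem measurableSet_I0 : MeasurableSet G.I0 := measurableSet_Ioo

/-- The product `χ_{I₀} f` of `f ∈ L²(Ω)` with the indicator function of `I₀`. -/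
def cutoff (f : G.L2) : G.L2 := ((Lp.memLp f).indicator G.measurableSet_I0).toLp

theorem cutoff_ae (f : G.L2) : G.cutoff f =ᵐ[volume.restrict G.Omega] G.I0.indicator f :=
  MemLp.coeFn_toLp _

theorem cutoff_add (f g : G.L2) : G.cutoff (f + g) = G.cutoff f + G.cutoff g := by
  refine Lp.ext ?_
  filter_upwards [G.cutoff_ae (f + g), G.cutoff_ae f, G.cutoff_ae g, Lp.coeFn_add f g,
    Lp.coeFn_add (G.cutoff f) (G.cutoff g)] with x h1 h2 h3 h4 h5
  rw [h5, Pi.add_apply, h1, h2, h3]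
  by_cases h : x ∈ G.I0
  · simp only [indicator_of_mem h, h4, Pi.add_apply]
  · simp only [indicator_of_notMem h, add_zero]

theorem cutoff_smul (k : ℂ) (f : G.L2) : G.cutoff (k • f) = k • G.cutoff f := by
  refine Lp.ext ?_
  filter_upwards [G.cutoff_ae (k • f), G.cutoff_ae f, Lp.coeFn_smul k f,
    Lp.coeFn_smul k (G.cutoff f)] with x h1 h2 h3 h4
  rw [h4, Pi.smul_apply, h1, h2]
  by_cases h : x ∈ G.I0 <;> simp [h, h3]

theorem norm_cutoff_le (f : G.L2) : ‖G.cutoff f‖ ≤ ‖f‖ := by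
  refine Lp.norm_le_norm_of_ae_le ?_
  filter_upwards [G.cutoff_ae f] with x h1
  rw [h1]
  exact norm_indicator_le_norm_self _ _

theorem cutoff_cutoff (f : G.L2) : G.cutoff (G.cutoff f) = G.cutoff f := by
  refine Lp.ext ?_
  filter_upwards [G.cutoff_ae (G.cutoff f), G.cutoff_ae f] with x h1 h2
  rw [h1, h2]
  by_cases hx : x ∈ G.I0 <;> simp [hx, h2]

/-- The projection `P₀` of `L²(Ω)`: multiplication by the indicator function of `I₀`. -/
def P0 : G.L2 →L[ℂ] G.L2 :=
  LinearMap.mkContinuous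
    { toFun := G.cutoff
      map_add' := G.cutoff_add
      map_smul' := G.cutoff_smul } 1
    (fun f => (G.norm_cutoff_le f).trans_eq (one_mul _).symm)

/-- `L²(I₀)`, as the closed subspace of all `f ∈ L²(Ω)` with `χ_{I₀} f = f`. -/
def L2I0 : Submodule ℂ G.L2 where
  carrier := {f | G.P0 f = f}
  add_mem' {f g} hf hg := (map_add G.P0 f g).trans (congrArg₂ (· + ·) hf hg)
  zero_mem' := map_zero G.P0
  smul_mem' k f hf := (map_smul G.P0 k f).trans (congrArg (k • ·) hf)

theorem P0_mem (f : G.L2) : G.P0 f ∈ G.L2I0 := G.cutoff_cutoff f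

/-- The compression `P₀ T P₀` of a bounded operator `T` of `L²(Ω)`, as an operator
`L²(I₀) → L²(I₀)`. -/
def compression (T : G.L2 →L[ℂ] G.L2) : G.L2I0 →L[ℂ] G.L2I0 :=
  ((G.P0 ∘L T ∘L G.P0) ∘L G.L2I0.subtypeL).codRestrict G.L2I0 (fun _ => G.P0_mem _)

end Obstacles

/-- `U` is the strongly continuous unitary one-parameter group `U(t) = exp(-itA)`, that is, the one
whose infinitesimal generator (with its exact domain) is `-iA`. -/
structure IsUnitaryGroupOf {H : Type*} [NormedAddCommGroup H] [InnerProductSpace ℂ H]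
    [CompleteSpace H] (A : H →ₗ.[ℂ] H) (U : ℝ → H →L[ℂ] H) : Prop where
  unitary : ∀ t, U t ∈ unitary (H →L[ℂ] H)
  map_zero : U 0 = 1
  map_add : ∀ s t, U (s + t) = U s * U t
  continuous : ∀ f, Continuous fun t => U t f
  domain : ∀ f, f ∈ A.domain ↔ DifferentiableAt ℝ (fun t => U t f) 0
  hasDerivAt : ∀ f : A.domain, HasDerivAt (fun t : ℝ => U t f) (-Complex.I • A f) 0

/-- `Z` is a (strongly continuous) contraction semigroup on `H`. -/
structure IsContractionSemigroup {H : Type*} [NormedAddCommGroup H] [NormedSpace ℂ H]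
    (Z : ℝ≥0 → H →L[ℂ] H) : Prop where
  norm_le_one : ∀ t, ‖Z t‖ ≤ 1
  map_add : ∀ t s, Z t * Z s = Z (t + s)
  map_zero : Z 0 = 1
  continuous : ∀ f, Continuous fun t => Z t f

end LaxPhillips

end

/-! The generator is `-iκP_B = -v d/dx` with `v = κ/(2π)`, so `U(t)` transports mass to the right
with speed `v`. What reaches a right end point `a` or `c` re-enters at the left end points `b` and
`d`, as prescribed by `B`. Hence nothing enters `I₋`, and nothing leaves `I₊`. If `f` lives on `I₀`,
then `U(s)f` has no part on `I₋`. Its part outside `I₀` therefore lies on `I₊`, stays there under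
`U(t)`, and is killed by `P₀`. This gives `P₀U(t)P₀U(s)P₀ = P₀U(t+s)P₀`. Contractivity and
continuity are inherited from `U`.

The proof makes this an energy estimate rather than a formula for `U`. For `f` in the domain, `-v
d/dx` changes `‖f‖²` on `I₋` at rate `-v|f(a)|²`. On `I₋ ∪ I₀` the rate is `-v(|f(a)|² + |f(c)|² -
|f(b)|²)`, which is `-v|f(d)|²` because `B` preserves norms. Both are nonpositive, so both masses
decrease in time (`norm_restr_apply_le`), and a mass that is zero stays zero. The semigroup law is
`P0_apply_P0_apply_P0`.

Existence and uniqueness of `U` come from Stone's theorem (`existsUnique_isUnitaryGroupOf`), proved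
for a skew-symmetric `D` with `s - D` onto for all real `s ≠ 0`. Skew-symmetry is the vanishing of
the total flux. Surjectivity means solving `F' + μF = g` in `L²` on each component and matching the
boundary values (`exists_isRep`). -/

noncomputable section

/-! ### Skew-symmetric operators with full range and their resolvents. -/

namespace LaxPhillips

variable {H : Type*} [NormedAddCommGroup H] [InnerProductSpace ℂ H]

theorem hasDerivAt_norm_sq {u : ℝ → H} {u' : H} {t : ℝ} (hu : HasDerivAt u u' t) :
    HasDerivAt (fun t => ‖u t‖ ^ 2) (2 * (inner ℂ u' (u t)).re) t := by
  have h := Complex.reCLM.hasFDerivAt.comp_hasDerivAt t (hu.inner ℂ hu)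
  have e : (fun t => ‖u t‖ ^ 2) = Complex.reCLM ∘ fun t => inner ℂ (u t) (u t) :=
    funext fun s => norm_sq_eq_re_inner (𝕜 := ℂ) (u s)
  rw [e]
  refine h.congr_deriv ?_
  have h2 := inner_re_symm (𝕜 := ℂ) (u t) u'
  simp only [RCLike.re_to_complex] at h2
  rw [Complex.reCLM_apply, Complex.add_re, h2, two_mul]

/-- A skew-symmetric operator `D` such that `s - D` is onto for all real `s ≠ 0`. -/
structure IsSkewGenerator (D : H →ₗ.[ℂ] H) : Prop where
  re_inner : ∀ f : D.domain, (inner ℂ (D f) (f : H)).re = 0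
  surjective : ∀ s : ℝ, s ≠ 0 → ∀ g, ∃ f : D.domain, (s : ℂ) • (f : H) - D f = g

namespace IsSkewGenerator

variable {D : H →ₗ.[ℂ] H} (hD : IsSkewGenerator D)
include hD

/-- Polarisation: the real part comes from `f + g`, the imaginary part from replacing `f` by `i f`.
-/
theorem inner_apply (f g : D.domain) : inner ℂ (D f) (g : H) = -inner ℂ (f : H) (D g) := by
  have key : ∀ f g : D.domain, (inner ℂ (D f) (g : H)).re = -(inner ℂ (f : H) (D g)).re := by
    intro f g
    have h1 := hD.re_inner (f + g)
    have h2 := hD.re_inner f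
    have h3 := hD.re_inner g
    rw [D.map_add, Submodule.coe_add] at h1
    simp only [inner_add_left, inner_add_right, Complex.add_re] at h1
    have h4 := inner_re_symm (𝕜 := ℂ) (f : H) (D g)
    simp only [RCLike.re_to_complex] at h4
    linarith
  refine Complex.ext (key f g) ?_
  have h := key (Complex.I • f) g
  rw [D.map_smul, Submodule.coe_smul] at h
  simpa [inner_smul_left] using h

theorem norm_sq_apply (s : ℝ) (f : D.domain) :
    ‖(s : ℂ) • (f : H) - D f‖ ^ 2 = s ^ 2 * ‖(f : H)‖ ^ 2 + ‖D f‖ ^ 2 := by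
  rw [@norm_sub_sq ℂ]
  have h1 := hD.re_inner f
  have h4 := inner_re_symm (𝕜 := ℂ) (f : H) (D f)
  simp only [RCLike.re_to_complex] at h4
  have : RCLike.re (inner ℂ ((s : ℂ) • (f : H)) (D f)) = 0 := by
    rw [inner_smul_left]
    simp [h4, h1]
  rw [this, norm_smul, mul_pow]
  simp

theorem norm_le (s : ℝ) (f : D.domain) : |s| * ‖(f : H)‖ ≤ ‖(s : ℂ) • (f : H) - D f‖ := by
  refine le_of_sq_le_sq ?_ (norm_nonneg _)
  rw [hD.norm_sq_apply, mul_pow, sq_abs]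
  nlinarith [sq_nonneg ‖D f‖]

theorem existsUnique (s : ℝ) (hs : s ≠ 0) (g : H) :
    ∃! f : D.domain, (s : ℂ) • (f : H) - D f = g := by
  obtain ⟨f, hf⟩ := hD.surjective s hs g
  refine ⟨f, hf, fun f' hf' => ?_⟩
  have h := hD.norm_le s (f' - f)
  have e : (s : ℂ) • ((f' - f : D.domain) : H) - D (f' - f) = 0 := by
    rw [D.map_sub, Submodule.coe_sub, smul_sub, sub_sub_sub_comm]
    simp only at hf'
    rw [hf', hf, sub_self]
  rw [e, norm_zero] at h
  have h2 : ‖((f' - f : D.domain) : H)‖ = 0 := by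
    have := abs_pos.mpr hs
    have h3 := norm_nonneg ((f' - f : D.domain) : H)
    nlinarith
  rw [norm_eq_zero, Submodule.coe_sub, sub_eq_zero] at h2
  exact Subtype.ext h2

theorem exists_resolvent (s : ℝ) (hs : s ≠ 0) : ∃ R : H →L[ℂ] H, ∀ g, ∃ f : D.domain,
    (f : H) = R g ∧ (s : ℂ) • (f : H) - D f = g := by
  choose r hr using fun g => (hD.existsUnique s hs g).exists
  have add : ∀ g g', r (g + g') = r g + r g' := fun g g' =>
    (hD.existsUnique s hs (g + g')).unique (hr _) (by
      rw [D.map_add, Submodule.coe_add, smul_add, add_sub_add_comm, hr, hr])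
  have smul : ∀ (k : ℂ) g, r (k • g) = k • r g := fun k g =>
    (hD.existsUnique s hs (k • g)).unique (hr _) (by
      rw [D.map_smul, Submodule.coe_smul, smul_comm, ← smul_sub, hr])
  refine ⟨LinearMap.mkContinuous
    { toFun := fun g => (r g : H)
      map_add' := fun g g' => by rw [add]; rfl
      map_smul' := fun k g => by rw [smul]; rfl } (|s|⁻¹) fun g => ?_, fun g => ⟨r g, rfl, hr g⟩⟩
  have h := hD.norm_le s (r g)
  rw [hr] at h
  rw [inv_mul_eq_div, le_div_iff₀ (abs_pos.mpr hs), mul_comm]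
  exact h

/-- The resolvent `(s - D)⁻¹` for real `s ≠ 0`. -/
def resolvent (s : ℝ) : H →L[ℂ] H :=
  open Classical in if hs : s ≠ 0 then (hD.exists_resolvent s hs).choose else 0

theorem resolvent_spec {s : ℝ} (hs : s ≠ 0) (g : H) : ∃ f : D.domain,
    (f : H) = hD.resolvent s g ∧ (s : ℂ) • (f : H) - D f = g := by
  rw [resolvent, dif_pos hs]
  exact (hD.exists_resolvent s hs).choose_spec g

theorem resolvent_apply {s : ℝ} (hs : s ≠ 0) (f : D.domain) :
    hD.resolvent s ((s : ℂ) • (f : H) - D f) = f := by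
  obtain ⟨f', h1, h2⟩ := hD.resolvent_spec hs ((s : ℂ) • (f : H) - D f)
  rw [← h1, (hD.existsUnique s hs _).unique h2 rfl]

theorem norm_resolvent_le {s : ℝ} (hs : s ≠ 0) (g : H) :
    |s| * ‖hD.resolvent s g‖ ≤ ‖g‖ := by
  obtain ⟨f, h1, h2⟩ := hD.resolvent_spec hs g
  have h := hD.norm_le s f
  rwa [h2, h1] at h

theorem resolvent_commute {s r : ℝ} (hs : s ≠ 0) (hr : r ≠ 0) :
    Commute (hD.resolvent s) (hD.resolvent r) := by
  by_cases hsr : s = r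
  · rw [hsr]
  -- The resolvent identity. Exchanging `s` and `r` and cancelling `r - s` gives commutation.
  have key : ∀ {s r : ℝ}, s ≠ 0 → r ≠ 0 → ∀ g,
      hD.resolvent s g - hD.resolvent r g
        = ((r - s : ℝ) : ℂ) • hD.resolvent s (hD.resolvent r g) := by
    intro s r hs hr g
    obtain ⟨f, h1, h2⟩ := hD.resolvent_spec hr g
    have h3 := hD.resolvent_apply hs f
    have e : (s : ℂ) • (f : H) - D f = g - ((r - s : ℝ) : ℂ) • (f : H) := by
      rw [← h2]; push_cast; module
    rw [e, map_sub, map_smul] at h3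
    rw [← h1]
    rw [sub_eq_iff_eq_add] at h3 ⊢
    rw [h3, add_comm]
  ext g
  have h1 := key hs hr g
  have h2 := key hr hs g
  have h3 : ((r - s : ℝ) : ℂ) ≠ 0 := by
    exact_mod_cast sub_ne_zero.mpr (Ne.symm hsr)
  have h4 : ((r - s : ℝ) : ℂ) • hD.resolvent s (hD.resolvent r g)
      = ((r - s : ℝ) : ℂ) • hD.resolvent r (hD.resolvent s g) := by
    rw [← h1, ← neg_sub, h2]; push_cast; module
  exact smul_right_injective H h3 h4

theorem inner_resolvent {s : ℝ} (hs : s ≠ 0) (g h : H) :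
    inner ℂ (hD.resolvent s g) h = -inner ℂ g (hD.resolvent (-s) h) := by
  obtain ⟨f, h1, h2⟩ := hD.resolvent_spec hs g
  obtain ⟨k, h3, h4⟩ := hD.resolvent_spec (neg_ne_zero.mpr hs) h
  rw [← h1, ← h3, ← h2, ← h4, inner_sub_left, inner_sub_right, hD.inner_apply, inner_smul_left,
    inner_smul_right]
  simp only [Complex.conj_ofReal, Complex.ofReal_neg]
  ring

/-- If `f = u - D u` is orthogonal to the domain, testing against `u` gives `0 = Re ⟨u, u - D u⟩ =
‖u‖²`. -/
theorem mem_closure_domain [CompleteSpace H] (f : H) : f ∈ closure (D.domain : Set H) := by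
  have h : D.domain.topologicalClosure = ⊤ := by
    rw [Submodule.topologicalClosure_eq_top_iff, Submodule.eq_bot_iff]
    intro f hf
    obtain ⟨u, hu⟩ := hD.surjective 1 one_ne_zero f
    have h1 := congrArg Complex.re (hf u u.2)
    have h2 := hD.re_inner u
    have h4 := inner_re_symm (𝕜 := ℂ) (u : H) (D u)
    have h5 := norm_sq_eq_re_inner (𝕜 := ℂ) (u : H)
    simp only [RCLike.re_to_complex] at h4 h5
    rw [← hu, Complex.ofReal_one, one_smul, inner_sub_right, Complex.sub_re, h4, h2, sub_zero,
      ← h5, Complex.zero_re, sq_eq_zero_iff, norm_eq_zero] at h1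
    have h6 : u = 0 := Subtype.ext h1
    rw [← hu, h6]
    simp
  rw [← Submodule.topologicalClosure_coe, h]
  trivial

/-- `s (s - D)⁻¹` converges strongly to the identity as `|s| → ∞`. -/
theorem tendsto_resolvent [CompleteSpace H] {s : ℕ → ℝ} (hs : ∀ᶠ n in atTop, s n ≠ 0)
    (hs' : Tendsto (fun n => |s n|) atTop atTop) (g : H) :
    Tendsto (fun n => (s n : ℂ) • hD.resolvent (s n) g) atTop (𝓝 g) := by
  -- On the domain `s R(s) f - f = R(s) D f`, of norm at most `‖D f‖ / |s|`. The bound `‖s R(s)‖ ≤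
  -- 1` and density then cover every `g`.
  have dom : ∀ f : D.domain,
      Tendsto (fun n => (s n : ℂ) • hD.resolvent (s n) (f : H)) atTop (𝓝 (f : H)) := by
    intro f
    rw [tendsto_iff_norm_sub_tendsto_zero]
    have hlim : Tendsto (fun n => ‖D f‖ * |s n|⁻¹) atTop (𝓝 0) := by
      simpa using (tendsto_inv_atTop_zero.comp hs').const_mul ‖D f‖
    refine squeeze_zero' (Eventually.of_forall fun _ => norm_nonneg _) ?_ hlim
    filter_upwards [hs] with n hn
    have h1 := hD.resolvent_apply hn f
    rw [map_sub, map_smul, sub_eq_iff_eq_add] at h1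
    rw [h1, add_sub_cancel_left, ← div_eq_mul_inv, le_div_iff₀ (abs_pos.mpr hn), mul_comm]
    exact hD.norm_resolvent_le hn _
  rw [Metric.tendsto_nhds]
  intro ε hε
  obtain ⟨f, hf, hfg⟩ := Metric.mem_closure_iff.mp (hD.mem_closure_domain g) (ε / 3) (by positivity)
  have h1 := (Metric.tendsto_nhds.mp (dom ⟨f, hf⟩)) (ε / 3) (by positivity)
  filter_upwards [hs, h1] with n hn h1
  have h2 : dist ((s n : ℂ) • hD.resolvent (s n) g) ((s n : ℂ) • hD.resolvent (s n) f)
      ≤ dist g f := by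
    rw [dist_eq_norm, dist_eq_norm, ← smul_sub, ← map_sub, norm_smul]
    simpa using hD.norm_resolvent_le hn (g - f)
  have h3 := dist_triangle4 ((s n : ℂ) • hD.resolvent (s n) g)
    ((s n : ℂ) • hD.resolvent (s n) f) f g
  rw [dist_comm f g] at h3
  linarith

end IsSkewGenerator
end LaxPhillips

/-! ### Stone's theorem by Yosida approximation. -/

namespace LaxPhillips

variable {H : Type*} [NormedAddCommGroup H] [InnerProductSpace ℂ H]

section BoundedGenerator

variable [CompleteSpace H] {E E' : H →L[ℂ] H}

theorem exp_smul_mem_unitary (hE : E ∈ skewAdjoint (H →L[ℂ] H)) (t : ℝ) :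
    NormedSpace.exp (t • E) ∈ unitary (H →L[ℂ] H) := by
  let _ : NormedAlgebra ℚ (H →L[ℂ] H) := NormedAlgebra.restrictScalars ℚ ℂ _
  refine NormedSpace.exp_mem_unitary_of_mem_skewAdjoint ?_
  rw [skewAdjoint.mem_iff] at hE ⊢
  rw [star_smul, hE, smul_neg, star_trivial]

theorem norm_exp_smul_apply (hE : E ∈ skewAdjoint (H →L[ℂ] H)) (t : ℝ) (f : H) :
    ‖NormedSpace.exp (t • E) f‖ = ‖f‖ :=
  ContinuousLinearMap.norm_map_of_mem_unitary (exp_smul_mem_unitary hE t) f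

theorem exp_add_smul (E : H →L[ℂ] H) (s t : ℝ) :
    NormedSpace.exp ((s + t) • E) = NormedSpace.exp (s • E) * NormedSpace.exp (t • E) := by
  let _ : NormedAlgebra ℚ (H →L[ℂ] H) := NormedAlgebra.restrictScalars ℚ ℂ _
  rw [add_smul, NormedSpace.exp_add_of_commute]
  exact ((Commute.refl E).smul_left s).smul_right t

theorem hasDerivAt_exp_smul_apply (E : H →L[ℂ] H) (f : H) (t : ℝ) :
    HasDerivAt (fun t : ℝ => NormedSpace.exp (t • E) f) (NormedSpace.exp (t • E) (E f)) t := by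
  have h := hasDerivAt_exp_smul_const (𝕂 := ℝ) E t
  exact ((ContinuousLinearMap.apply ℂ H f).restrictScalars ℝ).hasFDerivAt.comp_hasDerivAt t h

theorem norm_exp_smul_sub_le (hE : E ∈ skewAdjoint (H →L[ℂ] H)) (s t : ℝ) (f : H) :
    ‖NormedSpace.exp (t • E) f - NormedSpace.exp (s • E) f‖ ≤ ‖E f‖ * ‖t - s‖ :=
  Convex.norm_image_sub_le_of_norm_hasDerivWithin_le (s := univ)
    (fun x _ => (hasDerivAt_exp_smul_apply E f x).hasDerivWithinAt)
    (fun x _ => (norm_exp_smul_apply hE x (E f)).le) convex_univ (mem_univ s) (mem_univ t)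

/-- By commutation the difference is `exp(tE') (exp(t(E - E')) - 1) f`. The first factor is
isometric, and the second is bounded by the mean value inequality. -/
theorem norm_exp_smul_sub_exp_smul_le (hE : E ∈ skewAdjoint (H →L[ℂ] H))
    (hE' : E' ∈ skewAdjoint (H →L[ℂ] H)) (h : Commute E E') (t : ℝ) (f : H) :
    ‖NormedSpace.exp (t • E) f - NormedSpace.exp (t • E') f‖ ≤ ‖E f - E' f‖ * |t| := by
  let _ : NormedAlgebra ℚ (H →L[ℂ] H) := NormedAlgebra.restrictScalars ℚ ℂ _
  have h1 : NormedSpace.exp (t • E) = NormedSpace.exp (t • E') * NormedSpace.exp (t • (E - E')) := by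
    rw [← NormedSpace.exp_add_of_commute]
    · rw [smul_sub, add_sub_cancel]
    · exact ((h.symm.sub_right (Commute.refl E')).smul_left t).smul_right t
  have h2 := norm_exp_smul_sub_le (sub_mem hE hE') 0 t f
  rw [zero_smul, NormedSpace.exp_zero, one_apply_eq_self, sub_zero] at h2
  rw [h1, mul_apply_eq_comp, ← map_sub, norm_exp_smul_apply hE']
  exact h2

end BoundedGenerator

namespace IsSkewGenerator

variable {D : H →ₗ.[ℂ] H} (hD : IsSkewGenerator D)
include hD

/-- The symmetrised Yosida approximations of `D`. -/
def yosida (n : ℕ) : H →L[ℂ] H :=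
  (((n + 1 : ℝ) ^ 2 / 2 : ℝ) : ℂ) • (hD.resolvent (n + 1) + hD.resolvent (-(n + 1)))

theorem yosida_commute (m n : ℕ) : Commute (hD.yosida m) (hD.yosida n) := by
  have h : ∀ k : ℕ, (k + 1 : ℝ) ≠ 0 := fun k => by positivity
  have h' : ∀ k : ℕ, -(k + 1 : ℝ) ≠ 0 := fun k => neg_ne_zero.mpr (h k)
  refine Commute.smul_left (Commute.smul_right ?_ _) _
  exact ((hD.resolvent_commute (h m) (h n)).add_right (hD.resolvent_commute (h m) (h' n))).add_left
    ((hD.resolvent_commute (h' m) (h n)).add_right (hD.resolvent_commute (h' m) (h' n)))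

variable [CompleteSpace H]

/-- The adjoint of `R(s)` is `-R(-s)`, so the sum over `±s` is skew-adjoint. This is the purpose of
the symmetrisation: all the exponentials become unitary. -/
theorem yosida_mem_skewAdjoint (n : ℕ) : hD.yosida n ∈ skewAdjoint (H →L[ℂ] H) := by
  have h : (n + 1 : ℝ) ≠ 0 := by positivity
  rw [skewAdjoint.mem_iff, ContinuousLinearMap.star_eq_adjoint, eq_comm,
    ContinuousLinearMap.eq_adjoint_iff]
  intro x y
  have h1 := hD.inner_resolvent h x y
  have h2 := hD.inner_resolvent (neg_ne_zero.mpr h) x y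
  rw [neg_neg] at h2
  simp only [yosida, neg_apply, smul_apply,
    add_apply, inner_neg_left, inner_smul_left, inner_smul_right,
    inner_add_left, inner_add_right, h1, h2, Complex.conj_ofReal]
  ring

/-- On the domain `s² R(s) f = s f + s R(s) D f`. Averaging over `s = ±(n + 1)` cancels `s f` and
leaves two terms that each tend to `D f`. -/
theorem tendsto_yosida (f : D.domain) :
    Tendsto (fun n => hD.yosida n f) atTop (𝓝 (D f)) := by
  have h : ∀ k : ℕ, (k + 1 : ℝ) ≠ 0 := fun k => by positivity
  have h' : ∀ k : ℕ, -(k + 1 : ℝ) ≠ 0 := fun k => neg_ne_zero.mpr (h k)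
  have lim : Tendsto (fun n : ℕ => (n + 1 : ℝ)) atTop atTop :=
    tendsto_atTop_add_const_right _ _ tendsto_natCast_atTop_atTop
  have abs : (fun n : ℕ => |(n + 1 : ℝ)|) = fun n : ℕ => (n + 1 : ℝ) :=
    funext fun n => abs_of_pos (by positivity)
  have h1 := hD.tendsto_resolvent (Eventually.of_forall h) (by rw [abs]; exact lim) (D f)
  have h2 := hD.tendsto_resolvent (Eventually.of_forall h')
    (by simp only [abs_neg]; rw [abs]; exact lim) (D f)
  have h3 := (h1.add h2).const_smul (1 / 2 : ℂ)
  have e : (1 / 2 : ℂ) • (D f + D f) = D f := by module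
  rw [e] at h3
  refine h3.congr fun n => ?_
  have k1 := hD.resolvent_apply (h n) f
  have k2 := hD.resolvent_apply (h' n) f
  rw [map_sub, map_smul, sub_eq_iff_eq_add, ← sub_eq_iff_eq_add'] at k1 k2
  rw [← k1, ← k2, yosida, smul_apply, add_apply]
  push_cast
  module

theorem cauchySeq_exp_yosida (t : ℝ) (g : H) :
    CauchySeq fun n => NormedSpace.exp (t • hD.yosida n) g := by
  rw [Metric.cauchySeq_iff]
  intro ε hε
  obtain ⟨f, hf, hfg⟩ := Metric.mem_closure_iff.mp (hD.mem_closure_domain g) (ε / 3) (by positivity)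
  obtain ⟨N, hN⟩ := Metric.cauchySeq_iff.mp (hD.tendsto_yosida ⟨f, hf⟩).cauchySeq
    (ε / 3 / (|t| + 1)) (by positivity)
  refine ⟨N, fun m hm n hn => ?_⟩
  have key : ∀ n, dist (NormedSpace.exp (t • hD.yosida n) g) (NormedSpace.exp (t • hD.yosida n) f)
      = dist g f := fun n => by
    rw [dist_eq_norm, dist_eq_norm, ← map_sub, norm_exp_smul_apply (hD.yosida_mem_skewAdjoint n)]
  have h1 := key m
  have h2 := key n
  rw [dist_comm] at h2
  have h3 : dist (NormedSpace.exp (t • hD.yosida m) f) (NormedSpace.exp (t • hD.yosida n) f)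
      ≤ ε / 3 := by
    have h4 := norm_exp_smul_sub_exp_smul_le (hD.yosida_mem_skewAdjoint m)
      (hD.yosida_mem_skewAdjoint n) (hD.yosida_commute m n) t f
    have h5 := hN m hm n hn
    rw [dist_eq_norm, lt_div_iff₀ (by positivity)] at h5
    rw [dist_eq_norm]
    refine h4.trans (le_trans ?_ h5.le)
    gcongr
    linarith
  have h4 := dist_triangle4 (NormedSpace.exp (t • hD.yosida m) g)
    (NormedSpace.exp (t • hD.yosida m) f) (NormedSpace.exp (t • hD.yosida n) f)
    (NormedSpace.exp (t • hD.yosida n) g)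
  linarith

/-- The unitary group generated by `D`. -/
def group (t : ℝ) : H →L[ℂ] H :=
  continuousLinearMapOfTendsto (l := atTop) (fun n => NormedSpace.exp (t • hD.yosida n))
    (f := fun g => (cauchySeq_tendsto_of_complete (hD.cauchySeq_exp_yosida t g)).choose)
    (tendsto_pi_nhds.mpr fun g =>
      (cauchySeq_tendsto_of_complete (hD.cauchySeq_exp_yosida t g)).choose_spec)

theorem tendsto_group (t : ℝ) (g : H) :
    Tendsto (fun n => NormedSpace.exp (t • hD.yosida n) g) atTop (𝓝 (hD.group t g)) :=
  (cauchySeq_tendsto_of_complete (hD.cauchySeq_exp_yosida t g)).choose_spec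

theorem norm_group_apply (t : ℝ) (g : H) : ‖hD.group t g‖ = ‖g‖ := by
  refine tendsto_nhds_unique (hD.tendsto_group t g).norm ?_
  simp only [norm_exp_smul_apply (hD.yosida_mem_skewAdjoint _)]
  exact tendsto_const_nhds

theorem group_zero : hD.group 0 = 1 := by
  ext g
  refine tendsto_nhds_unique (hD.tendsto_group 0 g) ?_
  simp only [zero_smul, NormedSpace.exp_zero]
  exact tendsto_const_nhds

theorem group_add (s t : ℝ) : hD.group (s + t) = hD.group s * hD.group t := by
  ext g
  refine tendsto_nhds_unique (hD.tendsto_group (s + t) g) ?_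
  rw [mul_apply_eq_comp]
  -- Since `exp(s D_n)` is isometric, replacing the limit `U(t)g` by `exp(t D_n)g` inside it costs
  -- an error tending to zero.
  refine (hD.tendsto_group s (hD.group t g)).congr_dist ?_
  refine (tendsto_iff_dist_tendsto_zero.mp (hD.tendsto_group t g)).congr fun n => ?_
  rw [exp_add_smul, mul_apply_eq_comp, dist_comm, dist_eq_norm, dist_eq_norm,
    ← map_sub, norm_exp_smul_apply (hD.yosida_mem_skewAdjoint n)]

theorem group_mem_unitary (t : ℝ) : hD.group t ∈ unitary (H →L[ℂ] H) := by
  have h1 : hD.group t * hD.group (-t) = 1 := by rw [← group_add, add_neg_cancel, group_zero]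
  have h2 : hD.group (-t) * hD.group t = 1 := by rw [← group_add, neg_add_cancel, group_zero]
  refine IsUnit.mem_unitary_of_star_mul_self ⟨⟨_, _, h1, h2⟩, rfl⟩ ?_
  exact (ContinuousLinearMap.norm_map_iff_adjoint_comp_self _).mp (hD.norm_group_apply t)

theorem norm_group_sub_le (s t : ℝ) (f : D.domain) :
    ‖hD.group t f - hD.group s f‖ ≤ ‖D f‖ * ‖t - s‖ :=
  le_of_tendsto_of_tendsto' ((hD.tendsto_group t f).sub (hD.tendsto_group s f)).norm
    ((hD.tendsto_yosida f).norm.mul_const _)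
    fun n => norm_exp_smul_sub_le (hD.yosida_mem_skewAdjoint n) s t f

theorem continuous_group (g : H) : Continuous fun t => hD.group t g := by
  rw [Metric.continuous_iff]
  intro s ε hε
  obtain ⟨f, hf, hfg⟩ := Metric.mem_closure_iff.mp (hD.mem_closure_domain g) (ε / 3) (by positivity)
  refine ⟨ε / 3 / (‖D ⟨f, hf⟩‖ + 1), by positivity, fun t ht => ?_⟩
  have key : ∀ t, dist (hD.group t g) (hD.group t f) = dist g f := fun t => by
    rw [dist_eq_norm, dist_eq_norm, ← map_sub, hD.norm_group_apply]
  have h1 := key t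
  have h2 := key s
  rw [dist_comm] at h2
  have h3 : dist (hD.group t f) (hD.group s f) ≤ ε / 3 := by
    have h4 := hD.norm_group_sub_le s t ⟨f, hf⟩
    rw [dist_eq_norm, lt_div_iff₀ (by positivity)] at ht
    rw [dist_eq_norm]
    refine h4.trans (le_trans ?_ ht.le)
    rw [mul_comm]
    gcongr
    linarith
  have h4 := dist_triangle4 (hD.group t g) (hD.group t f) (hD.group s f) (hD.group s g)
  linarith

/-- Limit of the same formula for the bounded approximations. The dominating constant is a bound for
`‖D_n f‖`, which works because the exponentials are isometric. -/
theorem group_apply_eq_integral (f : D.domain) (t : ℝ) :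
    hD.group t f = f + ∫ s in 0..t, hD.group s (D f) := by
  have h1 : ∀ n, NormedSpace.exp (t • hD.yosida n) f
      = f + ∫ s in 0..t, NormedSpace.exp (s • hD.yosida n) (hD.yosida n f) := by
    intro n
    rw [intervalIntegral.integral_eq_sub_of_hasDerivAt
      (fun s _ => hasDerivAt_exp_smul_apply (hD.yosida n) f s)]
    · simp
    · exact Continuous.intervalIntegrable (continuous_iff_continuousAt.mpr fun s =>
        (hasDerivAt_exp_smul_apply (hD.yosida n) (hD.yosida n f) s).continuousAt) _ _
  obtain ⟨C, hC⟩ := (hD.tendsto_yosida f).norm.bddAbove_range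
  refine tendsto_nhds_unique (hD.tendsto_group t f) ?_
  simp only [h1]
  refine tendsto_const_nhds.add ?_
  refine intervalIntegral.tendsto_integral_filter_of_dominated_convergence (fun _ => C) ?_ ?_ ?_ ?_
  · refine Eventually.of_forall fun n => Continuous.aestronglyMeasurable ?_
    exact continuous_iff_continuousAt.mpr fun s =>
        (hasDerivAt_exp_smul_apply (hD.yosida n) (hD.yosida n f) s).continuousAt
  · refine Eventually.of_forall fun n => ae_of_all _ fun s _ => ?_
    rw [norm_exp_smul_apply (hD.yosida_mem_skewAdjoint n)]
    exact hC ⟨n, rfl⟩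
  · exact intervalIntegrable_const
  · refine ae_of_all _ fun s _ => ?_
    refine (hD.tendsto_group s (D f)).congr_dist ?_
    have := tendsto_iff_dist_tendsto_zero.mp (hD.tendsto_yosida f)
    refine this.congr fun n => ?_
    rw [dist_comm, dist_eq_norm, dist_eq_norm, ← map_sub,
      norm_exp_smul_apply (hD.yosida_mem_skewAdjoint n)]

theorem hasDerivAt_group_zero (f : D.domain) : HasDerivAt (fun t => hD.group t f) (D f) 0 := by
  have h : (fun t => hD.group t f) = fun t => f + ∫ s in 0..t, hD.group s (D f) :=
    funext (hD.group_apply_eq_integral f)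
  rw [h]
  have hc := hD.continuous_group (D f)
  have h2 := (intervalIntegral.integral_hasDerivAt_right (hc.intervalIntegrable 0 0)
    hc.aestronglyMeasurable.stronglyMeasurableAtFilter hc.continuousAt).const_add (f : H)
  simpa [group_zero] using h2

/-- Let `f'` be the derivative of the orbit at `0` and solve `k - D k = f - f'`. The orbit of `f -
k` then has derivative `f - k` at `0`, so its constant squared norm has derivative `2‖f - k‖²`.
Hence `f = k`. -/
theorem mem_domain_of_differentiableAt {f : H}
    (hf : DifferentiableAt ℝ (fun t => hD.group t f) 0) : f ∈ D.domain := by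
  obtain ⟨k, hk⟩ := hD.surjective 1 one_ne_zero (f - deriv (fun t => hD.group t f) 0)
  have h1 : HasDerivAt (fun t => hD.group t (f - k)) (f - k) 0 := by
    simp only [map_sub]
    refine (hf.hasDerivAt.sub (hD.hasDerivAt_group_zero k)).congr_deriv ?_
    rw [Complex.ofReal_one, one_smul, sub_eq_iff_eq_add] at hk
    rw [hk]
    abel
  have h2 := hasDerivAt_norm_sq h1
  simp only [hD.norm_group_apply] at h2
  have h3 := h2.unique (hasDerivAt_const _ _)
  have h4 := norm_sq_eq_re_inner (𝕜 := ℂ) (f - k)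
  simp only [RCLike.re_to_complex] at h4
  rw [group_zero, one_apply_eq_self, ← h4] at h3
  have h5 : f - k = 0 := by simpa using h3
  rw [sub_eq_zero.mp h5]
  exact k.2

end IsSkewGenerator

section Stone

variable [CompleteSpace H] {A : H →ₗ.[ℂ] H}

theorem isUnitaryGroupOf_group (hD : IsSkewGenerator (-Complex.I • A)) :
    IsUnitaryGroupOf A hD.group where
  unitary := hD.group_mem_unitary
  map_zero := hD.group_zero
  map_add := hD.group_add
  continuous := hD.continuous_group
  domain f := ⟨fun hf => (hD.hasDerivAt_group_zero ⟨f, hf⟩).differentiableAt,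
    hD.mem_domain_of_differentiableAt⟩
  hasDerivAt f := hD.hasDerivAt_group_zero f

namespace IsUnitaryGroupOf

variable {U V : ℝ → H →L[ℂ] H}

theorem norm_apply (hU : IsUnitaryGroupOf A U) (t : ℝ) (f : H) : ‖U t f‖ = ‖f‖ :=
  ContinuousLinearMap.norm_map_of_mem_unitary (hU.unitary t) f

theorem apply_mem_domain (hU : IsUnitaryGroupOf A U) (t : ℝ) (f : A.domain) :
    U t f ∈ A.domain := by
  rw [hU.domain]
  have h := ((U t).restrictScalars ℝ).hasFDerivAt.comp_hasDerivAt 0 (hU.hasDerivAt f)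
  refine h.differentiableAt.congr_of_eventuallyEq (Eventually.of_forall fun s => ?_)
  simp only [Function.comp, ContinuousLinearMap.coe_restrictScalars']
  rw [← mul_apply_eq_comp, ← mul_apply_eq_comp, ← hU.map_add,
    ← hU.map_add, add_comm]

theorem hasDerivAt_apply (hU : IsUnitaryGroupOf A U) (t : ℝ) (f : A.domain) :
    HasDerivAt (fun t : ℝ => U t f) (-Complex.I • A ⟨U t f, hU.apply_mem_domain t f⟩) t := by
  have h := hU.hasDerivAt ⟨U t f, hU.apply_mem_domain t f⟩
  have h2 : HasDerivAt (fun s : ℝ => s - t) 1 t := (hasDerivAt_id t).sub_const t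
  have h3 := HasDerivAt.scomp_of_eq t h h2 (sub_self t).symm
  rw [one_smul] at h3
  refine h3.congr_of_eventuallyEq (Eventually.of_forall fun s => ?_)
  simp only [Function.comp]
  rw [← mul_apply_eq_comp, ← hU.map_add, sub_add_cancel]

theorem unique (hD : IsSkewGenerator (-Complex.I • A)) (hU : IsUnitaryGroupOf A U)
    (hV : IsUnitaryGroupOf A V) : U = V := by
  funext t
  have dom : EqOn (U t) (V t) (A.domain : Set H) := by
    intro f hf
    let f : A.domain := ⟨f, hf⟩
    -- The difference of the orbits stays in the domain and solves the same equation, so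
    -- skew-symmetry keeps its norm constant.
    have h : ∀ t, HasDerivAt (fun t => ‖U t f - V t f‖ ^ 2) 0 t := by
      intro t
      have h1 := hasDerivAt_norm_sq ((hU.hasDerivAt_apply t f).sub (hV.hasDerivAt_apply t f))
      have h2 := hD.re_inner
        (⟨U t f, hU.apply_mem_domain t f⟩ - ⟨V t f, hV.apply_mem_domain t f⟩ : A.domain)
      rw [LinearPMap.smul_apply, LinearPMap.map_sub, smul_sub] at h2
      refine h1.congr_deriv ?_
      simp only [Pi.sub_apply]
      rw [Submodule.coe_sub] at h2
      simp only at h2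
      rw [h2, mul_zero]
    have h3 := is_const_of_deriv_eq_zero (fun t => (h t).differentiableAt) (fun t => (h t).deriv)
      t 0
    simp only [hU.map_zero, hV.map_zero, sub_self, norm_zero] at h3
    have h4 : U t f - V t f = 0 := by simpa using h3
    exact sub_eq_zero.mp h4
  ext g
  have := dom.closure (U t).continuous (V t).continuous
  exact this (hD.mem_closure_domain g)

end IsUnitaryGroupOf

/-- **Stone's theorem**: a skew-symmetric operator with full range conditions generates a unique
unitary group. -/
theorem existsUnique_isUnitaryGroupOf (hD : IsSkewGenerator (-Complex.I • A)) :
    ∃! U : ℝ → H →L[ℂ] H, IsUnitaryGroupOf A U :=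
  ⟨hD.group, isUnitaryGroupOf_group hD, fun _ hU => hU.unique hD (isUnitaryGroupOf_group hD)⟩

end Stone

end LaxPhillips

/-! ### Absolutely continuous functions and boundary terms. -/

namespace LaxPhillips

theorem absolutelyContinuousOnInterval_of_dist_le {X Y Z : Type*} [PseudoMetricSpace X]
    [PseudoMetricSpace Y] [PseudoMetricSpace Z] {F : ℝ → X} {F₁ : ℝ → Y} {F₂ : ℝ → Z} {x y : ℝ}
    (h₁ : AbsolutelyContinuousOnInterval F₁ x y) (h₂ : AbsolutelyContinuousOnInterval F₂ x y)
    (h : ∀ s t, dist (F s) (F t) ≤ dist (F₁ s) (F₁ t) + dist (F₂ s) (F₂ t)) :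
    AbsolutelyContinuousOnInterval F x y := by
  refine squeeze_zero (fun E => Finset.sum_nonneg fun i _ => dist_nonneg) (fun E => ?_)
    (by simpa using Tendsto.add h₁ h₂)
  rw [← Finset.sum_add_distrib]
  exact Finset.sum_le_sum fun i _ => h _ _

theorem absolutelyContinuousOnInterval_congr {X : Type*} [PseudoMetricSpace X] {F F' : ℝ → X}
    {x y : ℝ} (hF : AbsolutelyContinuousOnInterval F x y) (h : EqOn F F' (uIcc x y)) :
    AbsolutelyContinuousOnInterval F' x y := by
  rw [absolutelyContinuousOnInterval_iff] at hF ⊢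
  intro ε hε
  obtain ⟨δ, hδ, hF⟩ := hF ε hε
  refine ⟨δ, hδ, fun E hE hE' => ?_⟩
  refine lt_of_eq_of_lt (Finset.sum_congr rfl fun i hi => ?_) (hF E hE hE')
  rw [h (hE.1 i hi).1, h (hE.1 i hi).2]

theorem absolutelyContinuousOnInterval_norm_sq {F : ℝ → ℂ} {x y : ℝ}
    (hF : AbsolutelyContinuousOnInterval F x y) :
    AbsolutelyContinuousOnInterval (fun t => ‖F t‖ ^ 2) x y := by
  have hre : AbsolutelyContinuousOnInterval (fun t => (F t).re) x y :=
    squeeze_zero (fun E => Finset.sum_nonneg fun i _ => dist_nonneg)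
      (fun E => Finset.sum_le_sum fun i _ => by
        rw [Real.dist_eq, dist_eq_norm, ← Complex.sub_re]; exact Complex.abs_re_le_norm _) hF
  have him : AbsolutelyContinuousOnInterval (fun t => (F t).im) x y :=
    squeeze_zero (fun E => Finset.sum_nonneg fun i _ => dist_nonneg)
      (fun E => Finset.sum_le_sum fun i _ => by
        rw [Real.dist_eq, dist_eq_norm, ← Complex.sub_im]; exact Complex.abs_im_le_norm _) hF
  have e : (fun t => ‖F t‖ ^ 2)
      = (fun t => (F t).re) * (fun t => (F t).re) + (fun t => (F t).im) * (fun t => (F t).im) := by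
    funext t
    simp [Complex.sq_norm, Complex.normSq_apply]
  rw [e]
  exact (hre.mul hre).add (him.mul him)

theorem absolutelyContinuousOnInterval_integral {u : ℝ → ℂ} (hu : LocallyIntegrable u)
    (x y : ℝ) : AbsolutelyContinuousOnInterval (fun t => ∫ s in (0 : ℝ)..t, u s) x y := by
  have hu' : ∀ s t, IntervalIntegrable u volume s t := fun s t =>
    (hu.integrableOn_isCompact isCompact_uIcc).intervalIntegrable
  have key : ∀ L : ℂ →L[ℝ] ℝ,
      AbsolutelyContinuousOnInterval (fun t => ∫ s in (0 : ℝ)..t, L (u s)) x y := by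
    intro L
    have hi : ∀ s t, IntervalIntegrable (fun s => L (u s)) volume s t := fun s t =>
      ⟨L.integrable_comp (hu' s t).1, L.integrable_comp (hu' s t).2⟩
    -- The interval is enlarged to contain the base point `0` of the primitive.
    refine ((hi (min x (min y 0)) (max x (max y 0))).absolutelyContinuousOnInterval_intervalIntegral
      (c := 0) ?_).mono (uIcc_subset_uIcc ?_ ?_) <;>
    · rw [mem_uIcc]
      left
      simp
  refine absolutelyContinuousOnInterval_of_dist_le (key Complex.reCLM) (key Complex.imCLM) ?_
  intro s t
  rw [Complex.reCLM.intervalIntegral_comp_comm (hu' _ _),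
    Complex.reCLM.intervalIntegral_comp_comm (hu' _ _),
    Complex.imCLM.intervalIntegral_comp_comm (hu' _ _),
    Complex.imCLM.intervalIntegral_comp_comm (hu' _ _), Real.dist_eq, Real.dist_eq, dist_eq_norm,
    ← map_sub, ← map_sub]
  exact Complex.norm_le_abs_re_add_abs_im _

/-- The fundamental theorem of calculus for the square of an absolutely continuous function. -/
theorem integral_two_mul_re_inner {F h : ℝ → ℂ} {x y : ℝ}
    (hF : AbsolutelyContinuousOnInterval F x y)
    (hd : ∀ᵐ t, t ∈ uIoc x y → HasDerivAt F (h t) t) :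
    IntervalIntegrable (fun t => 2 * (inner ℂ (h t) (F t)).re) volume x y ∧
      ∫ t in x..y, 2 * (inner ℂ (h t) (F t)).re = ‖F y‖ ^ 2 - ‖F x‖ ^ 2 := by
  have hF2 := absolutelyContinuousOnInterval_norm_sq hF
  have e : ∀ᵐ t, t ∈ uIoc x y →
      deriv (fun t => ‖F t‖ ^ 2) t = 2 * (inner ℂ (h t) (F t)).re := by
    filter_upwards [hd] with t ht hm
    exact (hasDerivAt_norm_sq (ht hm)).deriv
  refine ⟨hF2.intervalIntegrable_deriv.congr_ae ?_, ?_⟩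
  · rwa [EventuallyEq, ae_restrict_iff' measurableSet_uIoc]
  · rw [← hF2.integral_deriv_eq_sub]
    exact (intervalIntegral.integral_congr_ae e).symm

/-- Integrability of the derivative gives `‖F‖²` a limit at infinity, and integrability of `‖F‖²`
itself forces that limit to be zero. -/
theorem setIntegral_Ioi_two_mul_re_inner {F h : ℝ → ℂ} {d : ℝ}
    (hF : ∀ x ≥ d, AbsolutelyContinuousOnInterval F d x)
    (hd : ∀ᵐ t ∂volume.restrict (Ioi d), HasDerivAt F (h t) t)
    (hi : IntegrableOn (fun t => 2 * (inner ℂ (h t) (F t)).re) (Ioi d))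
    (hF2 : IntegrableOn (fun t => ‖F t‖ ^ 2) (Ioi d)) :
    ∫ t in Ioi d, 2 * (inner ℂ (h t) (F t)).re = -‖F d‖ ^ 2 := by
  have h1 := intervalIntegral_tendsto_integral_Ioi d hi tendsto_id
  have h2 : Tendsto (fun x => ‖F x‖ ^ 2 - ‖F d‖ ^ 2) atTop
      (𝓝 (∫ t in Ioi d, 2 * (inner ℂ (h t) (F t)).re)) := by
    refine h1.congr' ?_
    filter_upwards [Ici_mem_atTop d] with x hx
    refine (integral_two_mul_re_inner (hF x hx) ?_).2
    rw [ae_restrict_iff' measurableSet_Ioi] at hd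
    filter_upwards [hd] with t ht hm
    rw [uIoc_of_le hx] at hm
    exact ht hm.1
  have h3 := h2.add_const (‖F d‖ ^ 2)
  simp only [sub_add_cancel] at h3
  have h4 := IntegrableAtFilter.eq_zero_of_tendsto (μ := volume) ⟨Ioi d, Ioi_mem_atTop d, hF2⟩
    (fun s hs => by
      obtain ⟨b, hb⟩ := mem_atTop_sets.mp hs
      rw [← top_le_iff, ← Real.volume_Ici (a := b)]
      exact measure_mono hb) h3
  linarith

theorem setIntegral_Iic_two_mul_re_inner {F h : ℝ → ℂ} {a : ℝ}
    (hF : ∀ x ≤ a, AbsolutelyContinuousOnInterval F x a)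
    (hd : ∀ᵐ t ∂volume.restrict (Iic a), HasDerivAt F (h t) t)
    (hi : IntegrableOn (fun t => 2 * (inner ℂ (h t) (F t)).re) (Iic a))
    (hF2 : IntegrableOn (fun t => ‖F t‖ ^ 2) (Iic a)) :
    ∫ t in Iic a, 2 * (inner ℂ (h t) (F t)).re = ‖F a‖ ^ 2 := by
  have h1 := intervalIntegral_tendsto_integral_Iic a hi tendsto_id
  have h2 : Tendsto (fun x => ‖F a‖ ^ 2 - ‖F x‖ ^ 2) atBot
      (𝓝 (∫ t in Iic a, 2 * (inner ℂ (h t) (F t)).re)) := by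
    refine h1.congr' ?_
    filter_upwards [Iic_mem_atBot a] with x hx
    refine (integral_two_mul_re_inner (hF x hx) ?_).2
    rw [ae_restrict_iff' measurableSet_Iic] at hd
    filter_upwards [hd] with t ht hm
    rw [uIoc_of_le hx] at hm
    exact ht hm.2
  have h3 := h2.const_sub (‖F a‖ ^ 2)
  simp only [sub_sub_cancel] at h3
  have h4 := IntegrableAtFilter.eq_zero_of_tendsto (μ := volume) ⟨Iic a, Iic_mem_atBot a, hF2⟩
    (fun s hs => by
      obtain ⟨b, hb⟩ := mem_atBot_sets.mp hs
      rw [← top_le_iff, ← Real.volume_Iic (a := b)]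
      exact measure_mono hb) h3
  linarith

/-- The solutions of `F' + μ F = g`, parametrised by `C = F 0`. -/
def odeSol (μ : ℝ) (g : ℝ → ℂ) (C : ℂ) (x : ℝ) : ℂ :=
  (Real.exp (-(μ * x)) : ℂ) * (C + ∫ y in (0 : ℝ)..x, (Real.exp (μ * y) : ℂ) * g y)

/-! ### Square-integrable solutions of `F' + μF = g` on half-lines. -/

section odeSol

variable {μ : ℝ} {g : ℝ → ℂ}

theorem locallyIntegrable_exp_mul (hg : MemLp g 2) :
    LocallyIntegrable fun y => (Real.exp (μ * y) : ℂ) * g y := by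
  have h : LocallyIntegrable g := hg.locallyIntegrable (by norm_num)
  have hc : Continuous fun y : ℝ => (Real.exp (μ * y) : ℂ) := by fun_prop
  rw [← locallyIntegrableOn_univ] at h ⊢
  exact h.continuousOn_mul hc.continuousOn isOpen_univ.isLocallyClosed

theorem absolutelyContinuousOnInterval_odeSol (hg : MemLp g 2) (C : ℂ) (x y : ℝ) :
    AbsolutelyContinuousOnInterval (odeSol μ g C) x y := by
  have h1 : AbsolutelyContinuousOnInterval (fun x : ℝ => (Real.exp (-(μ * x)) : ℂ)) x y := by
    refine ContDiffOn.absolutelyContinuousOnInterval (ContDiff.contDiffOn ?_)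
    exact Complex.ofRealCLM.contDiff.comp
      (show ContDiff ℝ 1 fun x : ℝ => Real.exp (-(μ * x)) by fun_prop)
  have h2 : AbsolutelyContinuousOnInterval (fun _ : ℝ => C) x y :=
    ContDiffOn.absolutelyContinuousOnInterval contDiffOn_const
  exact h1.smul (h2.add (absolutelyContinuousOnInterval_integral (locallyIntegrable_exp_mul hg) x y))

theorem continuous_odeSol (hg : MemLp g 2) (C : ℂ) : Continuous (odeSol μ g C) := by
  refine continuous_iff_continuousAt.mpr fun x => ?_
  have h := (absolutelyContinuousOnInterval_odeSol (μ := μ) hg C (x - 1) (x + 1)).continuousOn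
  rw [uIcc_of_le (by linarith)] at h
  exact h.continuousAt (Icc_mem_nhds (by linarith) (by linarith))

theorem hasDerivAt_odeSol (hg : MemLp g 2) (C : ℂ) :
    ∀ᵐ x, HasDerivAt (odeSol μ g C) (-(μ : ℂ) * odeSol μ g C x + g x) x := by
  filter_upwards [LocallyIntegrable.ae_hasDerivAt_integral (locallyIntegrable_exp_mul (μ := μ) hg)] with x hx
  have h1 : HasDerivAt (fun x : ℝ => (Real.exp (-(μ * x)) : ℂ))
      ((Real.exp (-(μ * x)) * (-(μ * 1)) : ℝ) : ℂ) x :=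
    (((hasDerivAt_id x).const_mul μ).neg.exp).ofReal_comp
  refine (h1.mul ((hx 0).const_add C)).congr_deriv ?_
  have e : (Real.exp (-(μ * x)) : ℂ) * (Real.exp (μ * x) : ℂ) = 1 := by
    rw [← Complex.ofReal_mul, ← Real.exp_add, neg_add_cancel, Real.exp_zero, Complex.ofReal_one]
  rw [odeSol]
  push_cast at e ⊢
  linear_combination (g x) * e

/-- Reflection `x ↦ -x` changes the sign of `μ`, so `μ < 0` reduces to `μ > 0`. -/
theorem odeSol_neg (C : ℂ) (x : ℝ) :
    odeSol μ g C (-x) = -odeSol (-μ) (fun y => g (-y)) (-C) x := by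
  have h := intervalIntegral.integral_comp_neg (a := 0) (b := x)
    (fun y => (Real.exp (μ * y) : ℂ) * g y)
  rw [neg_zero, intervalIntegral.integral_symm (0 : ℝ) (-x)] at h
  rw [odeSol, odeSol, ← neg_eq_iff_eq_neg.mpr h]
  simp only [mul_neg, neg_mul, neg_neg]
  ring

/-- Integrate `(‖F‖²)' = -2μ‖F‖² + 2 Re ⟨g, F⟩`, using `2‖g‖‖F‖ ≤ ‖g‖²/μ + μ‖F‖²`. -/
theorem odeSol_energy (hμ : 0 < μ) (hg : MemLp g 2) (C : ℂ) {x y : ℝ} (hxy : x ≤ y) :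
    ‖odeSol μ g C y‖ ^ 2 + μ * ∫ t in x..y, ‖odeSol μ g C t‖ ^ 2
      ≤ ‖odeSol μ g C x‖ ^ 2 + (∫ t, ‖g t‖ ^ 2) / μ := by
  obtain ⟨h1, h2⟩ := integral_two_mul_re_inner
    (absolutelyContinuousOnInterval_odeSol (μ := μ) hg C x y)
    ((hasDerivAt_odeSol hg C).mono fun t ht _ => ht)
  have hg2 : Integrable fun t => ‖g t‖ ^ 2 := (memLp_two_iff_integrable_sq_norm hg.1).mp hg
  have hW : IntervalIntegrable (fun t => ‖odeSol μ g C t‖ ^ 2) volume x y :=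
    ((continuous_odeSol hg C).norm.pow 2).intervalIntegrable _ _
  have h3 : ∫ t in x..y, 2 * (inner ℂ (-(μ : ℂ) * odeSol μ g C t + g t) (odeSol μ g C t)).re
      ≤ ∫ t in x..y, (-μ * ‖odeSol μ g C t‖ ^ 2 + ‖g t‖ ^ 2 / μ) := by
    refine intervalIntegral.integral_mono_on hxy h1
      ((hW.const_mul _).add (hg2.intervalIntegrable.div_const _)) fun t _ => ?_
    have e1 : inner ℂ (-(μ : ℂ) * odeSol μ g C t) (odeSol μ g C t)
        = ((-μ * ‖odeSol μ g C t‖ ^ 2 : ℝ) : ℂ) := by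
      rw [← smul_eq_mul, inner_smul_left, inner_self_eq_norm_sq_to_K]
      simp
    rw [inner_add_left, e1, Complex.add_re, Complex.ofReal_re]
    have e2 : (inner ℂ (g t) (odeSol μ g C t)).re ≤ ‖g t‖ * ‖odeSol μ g C t‖ :=
      (Complex.re_le_norm _).trans (norm_inner_le_norm _ _)
    have e3 : ‖g t‖ ^ 2 / μ * μ = ‖g t‖ ^ 2 := div_mul_cancel₀ _ hμ.ne'
    have e4 := sq_nonneg (‖g t‖ / μ - ‖odeSol μ g C t‖)
    have e5 : μ * (‖g t‖ / μ - ‖odeSol μ g C t‖) ^ 2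
        = ‖g t‖ ^ 2 / μ - 2 * (‖g t‖ * ‖odeSol μ g C t‖) + μ * ‖odeSol μ g C t‖ ^ 2 := by
      field_simp
      ring
    nlinarith [mul_nonneg hμ.le e4]
  rw [h2, intervalIntegral.integral_add (hW.const_mul _) (hg2.intervalIntegrable.div_const _),
    intervalIntegral.integral_const_mul, intervalIntegral.integral_div] at h3
  have h4 : ∫ t in x..y, ‖g t‖ ^ 2 ≤ ∫ t, ‖g t‖ ^ 2 := by
    rw [intervalIntegral.integral_of_le hxy]
    exact setIntegral_le_integral hg2 (ae_of_all _ fun t => by positivity)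
  have h5 := div_le_div_of_nonneg_right h4 hμ.le
  linarith

theorem memLp_odeSol_Ioi (hμ : 0 < μ) (hg : MemLp g 2) (C : ℂ) (x₀ : ℝ) :
    MemLp (odeSol μ g C) 2 (volume.restrict (Ioi x₀)) := by
  have hc := continuous_odeSol (μ := μ) hg C
  rw [memLp_two_iff_integrable_sq_norm hc.aestronglyMeasurable]
  refine integrableOn_Ioi_of_intervalIntegral_norm_bounded (l := atTop) (b := id)
    ((‖odeSol μ g C x₀‖ ^ 2 + (∫ t, ‖g t‖ ^ 2) / μ) / μ) x₀ (fun x => ?_) tendsto_id ?_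
  · exact ((hc.norm.pow 2).integrableOn_Icc).mono_set Ioc_subset_Icc_self
  · filter_upwards [Ici_mem_atTop x₀] with x hx
    have h := odeSol_energy hμ hg C (show x₀ ≤ x from hx)
    simp only [norm_pow, norm_norm, id]
    rw [le_div_iff₀ hμ, mul_comm]
    nlinarith [sq_nonneg ‖odeSol μ g C x‖]

theorem integrableOn_exp_mul_apply_Iic (hμ : 0 < μ) (hg : MemLp g 2) :
    IntegrableOn (fun y => (Real.exp (μ * y) : ℂ) * g y) (Iic 0) := by
  have h : MemLp (fun y : ℝ => (Real.exp (μ * y) : ℂ)) 2 (volume.restrict (Iic 0)) := by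
    rw [memLp_two_iff_integrable_sq_norm (Continuous.aestronglyMeasurable (by fun_prop))]
    refine (integrableOn_exp_mul_Iic (show 0 < 2 * μ by linarith) 0).congr_fun (fun y _ => ?_)
      measurableSet_Iic
    simp only [Complex.norm_real, Real.norm_eq_abs, sq_abs]
    rw [← Real.exp_nat_mul]
    congr 1; push_cast; ring
  exact h.integrable_mul (hg.restrict _)

theorem exists_memLp_odeSol_Iio (hμ : 0 < μ) (hg : MemLp g 2) :
    ∃ C, ∀ x₀, MemLp (odeSol μ g C) 2 (volume.restrict (Iio x₀)) := by
  set u : ℝ → ℂ := fun y => (Real.exp (μ * y) : ℂ) * g y with hu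
  set M := (∫ t, ‖g t‖ ^ 2) / μ with hM
  have h1 := intervalIntegral_tendsto_integral_Iic 0 (integrableOn_exp_mul_apply_Iic hμ hg) tendsto_id
  -- This choice makes the solution `e^{-μx} ∫_{-∞}^x e^{μy} g(y) dy`, without the part growing at
  -- `-∞`.
  refine ⟨∫ y in Iic 0, u y, fun x₀ => ?_⟩
  -- The solution is the limit, as `z → -∞`, of those vanishing at `z`. The energy estimate started
  -- at `z` bounds these by `M`.
  have bound : ∀ x, ‖odeSol μ g (∫ y in Iic 0, u y) x‖ ^ 2 ≤ M := by
    intro x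
    have h2 : Tendsto (fun z => ‖odeSol μ g (∫ y in z..0, u y) x‖ ^ 2) atBot
        (𝓝 (‖odeSol μ g (∫ y in Iic 0, u y) x‖ ^ 2)) :=
      (((h1.add_const _).const_mul _).norm.pow 2)
    refine le_of_tendsto h2 ?_
    filter_upwards [Iic_mem_atBot x] with z hz
    have h3 := odeSol_energy hμ hg (∫ y in z..0, u y) (show z ≤ x from hz)
    have h4 : odeSol μ g (∫ y in z..0, u y) z = 0 := by
      rw [odeSol, intervalIntegral.integral_symm, neg_add_cancel, mul_zero]
    have h5 : 0 ≤ ∫ t in z..x, ‖odeSol μ g (∫ y in z..0, u y) t‖ ^ 2 :=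
      intervalIntegral.integral_nonneg hz fun t _ => by positivity
    rw [h4, norm_zero] at h3
    nlinarith [mul_nonneg hμ.le h5]
  have hc := continuous_odeSol (μ := μ) hg (∫ y in Iic 0, u y)
  rw [memLp_two_iff_integrable_sq_norm hc.aestronglyMeasurable]
  refine IntegrableOn.mono_set ?_ Iio_subset_Iic_self
  refine integrableOn_Iic_of_intervalIntegral_norm_bounded (l := atBot) (a := id)
    ((M + M) / μ) x₀ (fun x => ?_) tendsto_id ?_
  · exact ((hc.norm.pow 2).integrableOn_Icc).mono_set Ioc_subset_Icc_self
  · filter_upwards [Iic_mem_atBot x₀] with x hx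
    have h := odeSol_energy hμ hg (∫ y in Iic 0, u y) (show x ≤ x₀ from hx)
    simp only [norm_pow, norm_norm, id]
    rw [le_div_iff₀ hμ, mul_comm]
    nlinarith [sq_nonneg ‖odeSol μ g (∫ y in Iic 0, u y) x₀‖, bound x]

theorem memLp_comp_neg {f : ℝ → ℂ} {s : Set ℝ} (hs : MeasurableSet s)
    (hf : MemLp f 2 (volume.restrict s)) :
    MemLp (fun x => f (-x)) 2 (volume.restrict (Neg.neg ⁻¹' s)) :=
  hf.comp_measurePreserving ((Measure.measurePreserving_neg volume).restrict_preimage hs)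

theorem memLp_odeSol_Iio (hμ : μ < 0) (hg : MemLp g 2) (C : ℂ) (x₀ : ℝ) :
    MemLp (odeSol μ g C) 2 (volume.restrict (Iio x₀)) := by
  have hg' : MemLp (fun y => g (-y)) 2 :=
    hg.comp_measurePreserving (Measure.measurePreserving_neg volume)
  have h := memLp_comp_neg measurableSet_Ioi
    (memLp_odeSol_Ioi (neg_pos.mpr hμ) hg' (-C) (-x₀)).neg
  simp only [Pi.neg_apply, ← odeSol_neg, neg_neg] at h
  simpa using h

theorem exists_memLp_odeSol_Ioi (hμ : μ < 0) (hg : MemLp g 2) :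
    ∃ C, ∀ x₀, MemLp (odeSol μ g C) 2 (volume.restrict (Ioi x₀)) := by
  have hg' : MemLp (fun y => g (-y)) 2 :=
    hg.comp_measurePreserving (Measure.measurePreserving_neg volume)
  obtain ⟨C, hC⟩ := exists_memLp_odeSol_Iio (neg_pos.mpr hμ) hg'
  refine ⟨-C, fun x₀ => ?_⟩
  have h := memLp_comp_neg measurableSet_Iio (hC (-x₀)).neg
  have e : ∀ x, (-odeSol (-μ) (fun y => g (-y)) C) (-x) = odeSol μ g (-C) x := by
    intro x
    have := odeSol_neg (μ := μ) (g := g) (-C) (-x)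
    rw [neg_neg, neg_neg] at this
    rw [this, Pi.neg_apply]
  simp only [e] at h
  simpa using h

theorem exists_odeSol_eq (μ : ℝ) (g : ℝ → ℂ) (x : ℝ) (z : ℂ) : ∃ C, odeSol μ g C x = z := by
  refine ⟨Real.exp (μ * x) * z - ∫ y in (0 : ℝ)..x, (Real.exp (μ * y) : ℂ) * g y, ?_⟩
  rw [odeSol, sub_add_cancel, ← mul_assoc, ← Complex.ofReal_mul, ← Real.exp_add]
  simp

theorem exists_odeSol_eq_add (μ : ℝ) (g : ℝ → ℂ) (x y : ℝ) :
    ∃ γ, ∀ C, odeSol μ g C y = Real.exp (μ * (x - y)) * odeSol μ g C x + γ := by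
  refine ⟨odeSol μ g 0 y - Real.exp (μ * (x - y)) * odeSol μ g 0 x, fun C => ?_⟩
  have e : (Real.exp (μ * (x - y)) : ℂ) * (Real.exp (-(μ * x)) : ℂ) = Real.exp (-(μ * y)) := by
    rw [← Complex.ofReal_mul, ← Real.exp_add]
    congr 2; ring
  simp only [odeSol]
  linear_combination (-C) * e

end odeSol

end LaxPhillips

/-! ### Matching boundary values, and surjectivity of `s - D`. -/

namespace LaxPhillips

namespace Obstacles

variable {G : Obstacles} {B : Matrix (Fin 2) (Fin 2) ℂ}

theorem one_sub_mul_ne_zero {q z : ℂ} (hq : ‖q‖ < 1) (hz : ‖z‖ ≤ 1) : 1 - q * z ≠ 0 := by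
  intro h
  have h1 : q * z = 1 := (sub_eq_zero.mp h).symm
  have h2 : ‖q * z‖ < 1 := by
    rw [norm_mul]
    nlinarith [norm_nonneg q, norm_nonneg z]
  rw [h1, norm_one] at h2
  exact lt_irrefl _ h2

/-- For decaying solutions at the left end, the boundary condition can be solved for the values at
the left end points. -/
theorem exists_boundary_left (hB : B ∈ Matrix.unitaryGroup (Fin 2) ℂ) {q : ℂ} (hq : ‖q‖ < 1)
    (α γ : ℂ) : ∃ β δ, B *ᵥ ![β, δ] = ![α, q * β + γ] := by
  have hz : ‖star (B 1 0)‖ ≤ 1 := by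
    rw [norm_star]; exact entry_norm_bound_of_unitary hB 1 0
  have hne := one_sub_mul_ne_zero hq hz
  -- The first row of `(β, δ) = B* (α, qβ + γ)` is a scalar equation for `β`; the second row then
  -- defines `δ`.
  set β := (star (B 0 0) * α + star (B 1 0) * γ) / (1 - q * star (B 1 0)) with hβ
  have e : β = star (B 0 0) * α + star (B 1 0) * (q * β + γ) := by
    have := div_mul_cancel₀ (star (B 0 0) * α + star (B 1 0) * γ) hne
    rw [← hβ] at this
    linear_combination this
  refine ⟨β, star (B 0 1) * α + star (B 1 1) * (q * β + γ), ?_⟩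
  have e2 : ![β, star (B 0 1) * α + star (B 1 1) * (q * β + γ)] = star B *ᵥ ![α, q * β + γ] := by
    ext i
    fin_cases i
    · simpa [Matrix.mulVec, dotProduct, Fin.sum_univ_two, Matrix.star_apply] using e
    · simp [Matrix.mulVec, dotProduct, Fin.sum_univ_two, Matrix.star_apply]
  rw [e2, Matrix.mulVec_mulVec, Matrix.mem_unitaryGroup_iff.mp hB, Matrix.one_mulVec]

theorem exists_boundary_right (hB : B ∈ Matrix.unitaryGroup (Fin 2) ℂ) {q : ℂ} (hq : ‖q‖ < 1)
    (δ η : ℂ) : ∃ α γ, B *ᵥ ![q * γ + η, δ] = ![α, γ] := by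
  have hne := one_sub_mul_ne_zero hq (entry_norm_bound_of_unitary hB 1 0)
  set γ := (B 1 0 * η + B 1 1 * δ) / (1 - q * B 1 0) with hγ
  have e : B 1 0 * (q * γ + η) + B 1 1 * δ = γ := by
    have := div_mul_cancel₀ (B 1 0 * η + B 1 1 * δ) hne
    rw [← hγ] at this
    linear_combination -this
  refine ⟨B 0 0 * (q * γ + η) + B 0 1 * δ, γ, ?_⟩
  ext i
  fin_cases i
  · simp [Matrix.mulVec, dotProduct, Fin.sum_univ_two]
  · simpa [Matrix.mulVec, dotProduct, Fin.sum_univ_two] using e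

/-- Integrability uses up the constant on the half-line where `e^{-μx}` grows: `C₁` for `μ > 0`,
`C₃` for `μ < 0`. The other two serve the boundary condition. The middle interval is crossed in the
direction in which `e^{-μx}` decays, so that the factor `q` has modulus below `1`. -/
theorem exists_odeSol_boundary (hB : B ∈ Matrix.unitaryGroup (Fin 2) ℂ) {μ : ℝ} (hμ : μ ≠ 0)
    {g : ℝ → ℂ} (hg : MemLp g 2) : ∃ C₁ C₂ C₃,
      MemLp (odeSol μ g C₁) 2 (volume.restrict (Iio G.a)) ∧
      MemLp (odeSol μ g C₃) 2 (volume.restrict (Ioi G.d)) ∧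
      B *ᵥ ![odeSol μ g C₂ G.b, odeSol μ g C₃ G.d]
        = ![odeSol μ g C₁ G.a, odeSol μ g C₂ G.c] := by
  have hbc := G.hbc
  have hq : ∀ r : ℝ, r < 0 → ‖(Real.exp r : ℂ)‖ < 1 := fun r hr => by
    rw [Complex.norm_real, Real.norm_eq_abs, Real.abs_exp, Real.exp_lt_one_iff]
    exact hr
  rcases hμ.lt_or_gt with hμ | hμ
  · obtain ⟨C₃, hC₃⟩ := exists_memLp_odeSol_Ioi hμ hg
    obtain ⟨η, hη⟩ := exists_odeSol_eq_add μ g G.c G.b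
    obtain ⟨α, γ, h⟩ := exists_boundary_right hB
      (hq (μ * (G.c - G.b)) (mul_neg_of_neg_of_pos hμ (by linarith))) (odeSol μ g C₃ G.d) η
    obtain ⟨C₁, hC₁⟩ := exists_odeSol_eq μ g G.a α
    obtain ⟨C₂, hC₂⟩ := exists_odeSol_eq μ g G.c γ
    refine ⟨C₁, C₂, C₃, memLp_odeSol_Iio hμ hg _ _, hC₃ _, ?_⟩
    rw [hη C₂, hC₁, hC₂, h]
  · obtain ⟨C₁, hC₁⟩ := exists_memLp_odeSol_Iio hμ hg
    obtain ⟨γ, hγ⟩ := exists_odeSol_eq_add μ g G.b G.c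
    obtain ⟨β, δ, h⟩ := exists_boundary_left hB
      (hq (μ * (G.b - G.c)) (mul_neg_of_pos_of_neg hμ (by linarith))) (odeSol μ g C₁ G.a) γ
    obtain ⟨C₂, hC₂⟩ := exists_odeSol_eq μ g G.b β
    obtain ⟨C₃, hC₃⟩ := exists_odeSol_eq μ g G.d δ
    refine ⟨C₁, C₂, C₃, hC₁ _, memLp_odeSol_Ioi hμ hg _ _, ?_⟩
    rw [hγ C₂, hC₂, hC₃, h]

/-- The function equal to `F₁`, `F₂`, `F₃` on the closures of the three components of `Ω`. -/
def glue (G : Obstacles) (F₁ F₂ F₃ : ℝ → ℂ) (x : ℝ) : ℂ :=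
  if x ≤ G.a then F₁ x else if x ≤ G.c then F₂ x else F₃ x

theorem eqOn_glue_left (F₁ F₂ F₃ : ℝ → ℂ) : EqOn F₁ (G.glue F₁ F₂ F₃) (Iic G.a) :=
  fun _ hx => (if_pos hx).symm

theorem eqOn_glue_middle (F₁ F₂ F₃ : ℝ → ℂ) : EqOn F₂ (G.glue F₁ F₂ F₃) (Icc G.b G.c) := by
  intro x hx
  rw [glue, if_neg (not_le.mpr (G.hab.trans_le hx.1)), if_pos hx.2]

theorem eqOn_glue_right (F₁ F₂ F₃ : ℝ → ℂ) : EqOn F₃ (G.glue F₁ F₂ F₃) (Ici G.d) := by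
  intro x hx
  have h1 : G.c < x := G.hcd.trans_le hx
  have h2 : G.a < x := (G.hab.trans G.hbc).trans h1
  rw [glue, if_neg (not_le.mpr h2), if_neg (not_le.mpr h1)]

theorem isAC_glue {F₁ F₂ F₃ : ℝ → ℂ} (h₁ : ∀ x y, AbsolutelyContinuousOnInterval F₁ x y)
    (h₂ : ∀ x y, AbsolutelyContinuousOnInterval F₂ x y)
    (h₃ : ∀ x y, AbsolutelyContinuousOnInterval F₃ x y) : G.IsAC (G.glue F₁ F₂ F₃) where
  left x hx := absolutelyContinuousOnInterval_congr (h₁ x G.a) <| by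
    rw [uIcc_of_le hx]
    exact (eqOn_glue_left F₁ F₂ F₃).mono Icc_subset_Iic_self
  middle := absolutelyContinuousOnInterval_congr (h₂ G.b G.c) <| by
    rw [uIcc_of_le G.hbc.le]
    exact eqOn_glue_middle F₁ F₂ F₃
  right x hx := absolutelyContinuousOnInterval_congr (h₃ G.d x) <| by
    rw [uIcc_of_le hx]
    exact (eqOn_glue_right F₁ F₂ F₃).mono Icc_subset_Ici_self

theorem memLp_glue {F₁ F₂ F₃ : ℝ → ℂ} (h₁ : MemLp F₁ 2 (volume.restrict (Iio G.a)))
    (h₂ : MemLp F₂ 2 (volume.restrict (Ioo G.b G.c)))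
    (h₃ : MemLp F₃ 2 (volume.restrict (Ioi G.d))) :
    MemLp (G.glue F₁ F₂ F₃) 2 (volume.restrict G.Omega) := by
  rw [← memLp_indicator_iff_restrict measurableSet_Iio] at h₁
  rw [← memLp_indicator_iff_restrict measurableSet_Ioo] at h₂
  rw [← memLp_indicator_iff_restrict measurableSet_Ioi] at h₃
  refine MemLp.ae_eq ?_ (((h₁.add h₂).add h₃).restrict G.Omega)
  filter_upwards [ae_restrict_mem isOpen_Omega.measurableSet] with x hx
  have hab := G.hab
  have hbc := G.hbc
  have hcd := G.hcd
  simp only [Pi.add_apply]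
  rcases hx with (hx | hx) | hx
  · have hx' : x < G.a := hx
    rw [← eqOn_glue_left F₁ F₂ F₃ hx'.le, indicator_of_mem hx, indicator_of_notMem,
      indicator_of_notMem, add_zero, add_zero]
    · simp only [mem_Ioi]; linarith
    · simp only [mem_Ioo, not_and]; intro; linarith
  · have hx' : x ∈ Ioo G.b G.c := hx
    have hb : G.b < x := hx'.1
    have hc : x < G.c := hx'.2
    rw [← eqOn_glue_middle F₁ F₂ F₃ ⟨hx'.1.le, hx'.2.le⟩, indicator_of_notMem,
      indicator_of_mem hx', indicator_of_notMem, add_zero, zero_add]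
    · simp only [mem_Ioi]; linarith
    · simp only [mem_Iio]; linarith
  · have hx' : G.d < x := hx
    rw [← eqOn_glue_right F₁ F₂ F₃ hx'.le, indicator_of_notMem, indicator_of_notMem,
      indicator_of_mem hx, add_zero, zero_add]
    · simp only [mem_Ioo, not_and]; intro; linarith
    · simp only [mem_Iio]; linarith

theorem hasDerivAt_glue {F₁ F₂ F₃ k : ℝ → ℂ} {μ : ℂ}
    (h₁ : ∀ᵐ x, HasDerivAt F₁ (μ * F₁ x + k x) x) (h₂ : ∀ᵐ x, HasDerivAt F₂ (μ * F₂ x + k x) x)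
    (h₃ : ∀ᵐ x, HasDerivAt F₃ (μ * F₃ x + k x) x) :
    ∀ᵐ x ∂volume.restrict G.Omega,
      HasDerivAt (G.glue F₁ F₂ F₃) (μ * G.glue F₁ F₂ F₃ x + k x) x := by
  filter_upwards [ae_restrict_mem isOpen_Omega.measurableSet, ae_restrict_of_ae h₁,
    ae_restrict_of_ae h₂, ae_restrict_of_ae h₃] with x hx h1 h2 h3
  have key : ∀ {F : ℝ → ℂ} {s t : Set ℝ}, HasDerivAt F (μ * F x + k x) x →
      EqOn F (G.glue F₁ F₂ F₃) s → t ⊆ s → IsOpen t → x ∈ t →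
      HasDerivAt (G.glue F₁ F₂ F₃) (μ * G.glue F₁ F₂ F₃ x + k x) x := by
    intro F s t hF hs hts ht hx
    rw [← hs (hts hx)]
    exact hF.congr_of_eventuallyEq ((hs.mono hts).symm.eventuallyEq_of_mem (ht.mem_nhds hx))
  rcases hx with (hx | hx) | hx
  · exact key h1 (eqOn_glue_left F₁ F₂ F₃) Iio_subset_Iic_self isOpen_Iio hx
  · exact key h2 (eqOn_glue_middle F₁ F₂ F₃) Ioo_subset_Icc_self isOpen_Ioo hx
  · exact key h3 (eqOn_glue_right F₁ F₂ F₃) Ioi_subset_Ici_self isOpen_Ioi hx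

theorem exists_isRep (hB : B ∈ Matrix.unitaryGroup (Fin 2) ℂ) {μ : ℝ} (hμ : μ ≠ 0) (g : G.L2) :
    ∃ f h F, G.IsRep f h F ∧ G.BoundaryCondition B F ∧ h = -(μ : ℂ) • f + g := by
  -- Extending `g` by zero lets the same solution formula on the whole line serve all three
  -- components.
  have hg : MemLp (G.Omega.indicator g) 2 :=
    (memLp_indicator_iff_restrict isOpen_Omega.measurableSet).mpr (Lp.memLp g)
  obtain ⟨C₁, C₂, C₃, h₁, h₃, hbc⟩ := exists_odeSol_boundary (G := G) hB hμ hg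
  have h₂ : MemLp (odeSol μ (G.Omega.indicator g) C₂) 2 (volume.restrict (Ioo G.b G.c)) := by
    have hc := continuous_odeSol (μ := μ) hg C₂
    rw [memLp_two_iff_integrable_sq_norm hc.aestronglyMeasurable]
    exact (hc.norm.pow 2).integrableOn_Icc.mono_set Ioo_subset_Icc_self
  have hF := memLp_glue h₁ h₂ h₃
  set F := G.glue (odeSol μ (G.Omega.indicator g) C₁) (odeSol μ (G.Omega.indicator g) C₂)
    (odeSol μ (G.Omega.indicator g) C₃) with hFdef
  refine ⟨hF.toLp, _, F, ⟨?_, hF.coeFn_toLp, ?_⟩, ?_, rfl⟩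
  · exact isAC_glue (absolutelyContinuousOnInterval_odeSol hg C₁)
      (absolutelyContinuousOnInterval_odeSol hg C₂) (absolutelyContinuousOnInterval_odeSol hg C₃)
  · filter_upwards [hasDerivAt_glue (G := G) (hasDerivAt_odeSol hg C₁) (hasDerivAt_odeSol hg C₂)
      (hasDerivAt_odeSol hg C₃), hF.coeFn_toLp, Lp.coeFn_add (-(μ : ℂ) • hF.toLp) g,
      Lp.coeFn_smul (-(μ : ℂ)) hF.toLp, ae_restrict_mem isOpen_Omega.measurableSet]
      with x h1 h2 h3 h4 h5
    rw [h3, Pi.add_apply, h4, Pi.smul_apply, h2, smul_eq_mul]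
    rwa [indicator_of_mem h5, ← hFdef] at h1
  · have ha := eqOn_glue_left (G := G) (odeSol μ (G.Omega.indicator g) C₁)
      (odeSol μ (G.Omega.indicator g) C₂) (odeSol μ (G.Omega.indicator g) C₃) self_mem_Iic
    have hb := eqOn_glue_middle (G := G) (odeSol μ (G.Omega.indicator g) C₁)
      (odeSol μ (G.Omega.indicator g) C₂) (odeSol μ (G.Omega.indicator g) C₃)
      (left_mem_Icc.mpr G.hbc.le)
    have hc := eqOn_glue_middle (G := G) (odeSol μ (G.Omega.indicator g) C₁)
      (odeSol μ (G.Omega.indicator g) C₂) (odeSol μ (G.Omega.indicator g) C₃)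
      (right_mem_Icc.mpr G.hbc.le)
    have hd := eqOn_glue_right (G := G) (odeSol μ (G.Omega.indicator g) C₁)
      (odeSol μ (G.Omega.indicator g) C₂) (odeSol μ (G.Omega.indicator g) C₃) self_mem_Ici
    rw [BoundaryCondition, hFdef, ← ha, ← hb, ← hc, ← hd]
    exact hbc

/-- The generator `-iκ P_B = -(κ / 2π) d/dx`. -/
theorem generator_apply (κ : ℝ) (f : (-Complex.I • ((κ : ℂ) • G.momentum B)).domain) {h : G.L2}
    {F : ℝ → ℂ} (H : G.IsRep f h F) :
    (-Complex.I • ((κ : ℂ) • G.momentum B)) f = -((κ / (2 * Real.pi) : ℝ) : ℂ) • h := by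
  rw [← derivOf_eq (B := B) f H]
  change -Complex.I • (κ : ℂ) • (1 / (2 * Real.pi * Complex.I) : ℂ) • derivOf (B := B) f = _
  rw [smul_smul, smul_smul]
  congr 1
  have hpi : (Real.pi : ℂ) ≠ 0 := by exact_mod_cast Real.pi_ne_zero
  have hI := Complex.I_ne_zero
  push_cast
  field_simp

theorem generator_surjective (hB : B ∈ Matrix.unitaryGroup (Fin 2) ℂ) {κ : ℝ} (hκ : 0 < κ)
    {s : ℝ} (hs : s ≠ 0) (g : G.L2) :
    ∃ f : (-Complex.I • ((κ : ℂ) • G.momentum B)).domain,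
      (s : ℂ) • (f : G.L2) - (-Complex.I • ((κ : ℂ) • G.momentum B)) f = g := by
  set v : ℝ := κ / (2 * Real.pi) with hv
  have hv0 : v ≠ 0 := by positivity
  -- The equation `s f + v f' = g`, divided by `v`.
  obtain ⟨f, h, F, H, K, e⟩ := exists_isRep (G := G) hB (div_ne_zero hs hv0) ((v⁻¹ : ℂ) • g)
  refine ⟨⟨f, h, F, H, K⟩, ?_⟩
  rw [generator_apply κ _ H, ← hv]
  change (s : ℂ) • f - -(v : ℂ) • h = g
  have hv1 : (v : ℂ) ≠ 0 := by exact_mod_cast hv0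
  rw [e]
  rw [neg_smul, smul_add, smul_smul, smul_smul, mul_inv_cancel₀ hv1]
  push_cast
  rw [mul_neg, mul_div_cancel₀ _ hv1]
  module

end Obstacles

end LaxPhillips

/-! ### Energy flux and skew-symmetry of the generator. -/

namespace LaxPhillips

namespace Obstacles

variable {G : Obstacles} {B : Matrix (Fin 2) (Fin 2) ℂ}

theorem measurableSet_Omega : MeasurableSet G.Omega := isOpen_Omega.measurableSet

theorem Iio_subset_Omega : Iio G.a ⊆ G.Omega := fun _ hx => Or.inl (Or.inl hx)

theorem I0_subset_Omega : G.I0 ⊆ G.Omega := fun _ hx => Or.inl (Or.inr hx)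

theorem Ioi_subset_Omega : Ioi G.d ⊆ G.Omega := fun _ hx => Or.inr hx

theorem integrableOn_two_mul_re_inner (f h : G.L2) :
    IntegrableOn (fun x => 2 * (inner ℂ (h x) (f x)).re) G.Omega :=
  (L2.integrable_inner (𝕜 := ℂ) h f).re.const_mul 2

namespace IsRep

variable {f h : G.L2} {F : ℝ → ℂ}

theorem ae_inner_eq (H : G.IsRep f h F) : ∀ᵐ x ∂volume.restrict G.Omega,
    2 * (inner ℂ (h x) (f x)).re = 2 * (inner ℂ (h x) (F x)).re := by
  filter_upwards [H.ae_eq] with x hx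
  rw [hx]

theorem integrableOn_inner (H : G.IsRep f h F) :
    IntegrableOn (fun x => 2 * (inner ℂ (h x) (F x)).re) G.Omega :=
  (integrableOn_two_mul_re_inner f h).congr H.ae_inner_eq

theorem integrableOn_norm_sq (H : G.IsRep f h F) :
    IntegrableOn (fun x => ‖F x‖ ^ 2) G.Omega := by
  refine ((memLp_two_iff_integrable_sq_norm (Lp.memLp f).1).mp (Lp.memLp f)).congr ?_
  filter_upwards [H.ae_eq] with x hx
  rw [hx]

theorem setIntegral_left (H : G.IsRep f h F) :
    ∫ x in Iio G.a, 2 * (inner ℂ (h x) (f x)).re = ‖F G.a‖ ^ 2 := by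
  have hle := Measure.restrict_mono (Iio_subset_Omega (G := G)) (le_refl (volume : Measure ℝ))
  rw [integral_congr_ae (hle.absolutelyContinuous.ae_le H.ae_inner_eq), ← integral_Iic_eq_integral_Iio]
  refine setIntegral_Iic_two_mul_re_inner H.ac.left ?_ ?_ ?_
  · rw [← restrict_Iio_eq_restrict_Iic]
    exact hle.absolutelyContinuous.ae_le H.hasDerivAt
  · rw [integrableOn_Iic_iff_integrableOn_Iio]
    exact H.integrableOn_inner.mono_set Iio_subset_Omega
  · rw [integrableOn_Iic_iff_integrableOn_Iio]
    exact H.integrableOn_norm_sq.mono_set Iio_subset_Omega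

theorem setIntegral_right (H : G.IsRep f h F) :
    ∫ x in Ioi G.d, 2 * (inner ℂ (h x) (f x)).re = -‖F G.d‖ ^ 2 := by
  have hle := Measure.restrict_mono (Ioi_subset_Omega (G := G)) (le_refl (volume : Measure ℝ))
  rw [integral_congr_ae (hle.absolutelyContinuous.ae_le H.ae_inner_eq)]
  exact setIntegral_Ioi_two_mul_re_inner H.ac.right (hle.absolutelyContinuous.ae_le H.hasDerivAt)
    (H.integrableOn_inner.mono_set Ioi_subset_Omega)
    (H.integrableOn_norm_sq.mono_set Ioi_subset_Omega)

theorem setIntegral_middle (H : G.IsRep f h F) :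
    ∫ x in G.I0, 2 * (inner ℂ (h x) (f x)).re = ‖F G.c‖ ^ 2 - ‖F G.b‖ ^ 2 := by
  have hle := Measure.restrict_mono (I0_subset_Omega (G := G)) (le_refl (volume : Measure ℝ))
  rw [integral_congr_ae (hle.absolutelyContinuous.ae_le H.ae_inner_eq), I0,
    ← integral_Ioc_eq_integral_Ioo, ← intervalIntegral.integral_of_le G.hbc.le]
  refine (integral_two_mul_re_inner H.ac.middle ?_).2
  rw [uIoc_of_le G.hbc.le, ← ae_restrict_iff' measurableSet_Ioc,
    ← restrict_Ioo_eq_restrict_Ioc]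
  exact hle.absolutelyContinuous.ae_le H.hasDerivAt

end IsRep

theorem Iio_a_inter_Omega : Iio G.a ∩ G.Omega = Iio G.a :=
  inter_eq_left.mpr Iio_subset_Omega

/-- Since the measure lives on `Ω`, the half-line below `c` represents the complement of `I₊`. -/
theorem Iio_c_inter_Omega : Iio G.c ∩ G.Omega = Iio G.a ∪ G.I0 := by
  have hab := G.hab
  have hbc := G.hbc
  have hcd := G.hcd
  ext x
  simp only [Omega, I0, mem_inter_iff, mem_union, mem_Iio, mem_Ioo, mem_Ioi]
  constructor
  · rintro ⟨h1, (h2 | h2) | h2⟩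
    · exact Or.inl h2
    · exact Or.inr h2
    · linarith
  · rintro (h | h)
    · exact ⟨by linarith, Or.inl (Or.inl h)⟩
    · exact ⟨h.2, Or.inl (Or.inr h)⟩

theorem disjoint_Iio_I0 : Disjoint (Iio G.a) G.I0 :=
  disjoint_left.mpr fun _ h1 h2 => lt_asymm (mem_Iio.mp h1) (G.hab.trans h2.1)

theorem disjoint_Iio_union_I0_Ioi : Disjoint (Iio G.a ∪ G.I0) (Ioi G.d) := by
  refine disjoint_left.mpr ?_
  have hab := G.hab
  have hbc := G.hbc
  have hcd := G.hcd
  rintro x (h1 | h1) h2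
  · have h1' : x < G.a := h1
    have h2' : G.d < x := h2
    linarith
  · have h1' : x < G.c := h1.2
    have h2' : G.d < x := h2
    linarith

theorem BoundaryCondition.norm_sq_eq (hB : B ∈ Matrix.unitaryGroup (Fin 2) ℂ) {F : ℝ → ℂ}
    (K : G.BoundaryCondition B F) :
    ‖F G.a‖ ^ 2 + ‖F G.c‖ ^ 2 = ‖F G.b‖ ^ 2 + ‖F G.d‖ ^ 2 := by
  have h1 : star (B *ᵥ ![F G.b, F G.d]) ⬝ᵥ (B *ᵥ ![F G.b, F G.d])
      = star ![F G.b, F G.d] ⬝ᵥ ![F G.b, F G.d] := by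
    have h2 : Bᴴ * B = 1 := Matrix.mem_unitaryGroup_iff'.mp hB
    rw [Matrix.star_mulVec, ← Matrix.dotProduct_mulVec, Matrix.mulVec_mulVec, h2,
      Matrix.one_mulVec]
  rw [K] at h1
  have e : ∀ z : ℂ, star z * z = ((‖z‖ ^ 2 : ℝ) : ℂ) := fun z => by
    simpa using Complex.conj_mul' z
  simp only [dotProduct, Fin.sum_univ_two, Pi.star_apply, Matrix.cons_val_zero,
    Matrix.cons_val_one, e] at h1
  exact_mod_cast h1

section energy

variable {f h : G.L2} {F : ℝ → ℂ}

/-- Under the boundary condition the right side equals `‖F d‖²`, so the flux out of `I₋ ∪ I₀` is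
nonnegative. -/
theorem setIntegral_Iio_c (H : G.IsRep f h F) :
    ∫ x in Iio G.c ∩ G.Omega, 2 * (inner ℂ (h x) (f x)).re
      = ‖F G.a‖ ^ 2 + (‖F G.c‖ ^ 2 - ‖F G.b‖ ^ 2) := by
  rw [Iio_c_inter_Omega, setIntegral_union disjoint_Iio_I0 G.measurableSet_I0
    ((integrableOn_two_mul_re_inner f h).mono_set Iio_subset_Omega)
    ((integrableOn_two_mul_re_inner f h).mono_set I0_subset_Omega), H.setIntegral_left,
    H.setIntegral_middle]

theorem setIntegral_Omega (H : G.IsRep f h F) :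
    ∫ x in G.Omega, 2 * (inner ℂ (h x) (f x)).re
      = ‖F G.a‖ ^ 2 + (‖F G.c‖ ^ 2 - ‖F G.b‖ ^ 2) - ‖F G.d‖ ^ 2 := by
  change ∫ x in Iio G.a ∪ G.I0 ∪ Ioi G.d, _ = _
  rw [← setIntegral_Iio_c H, Iio_c_inter_Omega, setIntegral_union disjoint_Iio_union_I0_Ioi measurableSet_Ioi
    ((integrableOn_two_mul_re_inner f h).mono_set subset_union_left)
    ((integrableOn_two_mul_re_inner f h).mono_set Ioi_subset_Omega), H.setIntegral_right,
    sub_eq_add_neg]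

end energy

theorem isSkewGenerator (hB : B ∈ Matrix.unitaryGroup (Fin 2) ℂ) {κ : ℝ} (hκ : 0 < κ) :
    IsSkewGenerator (-Complex.I • ((κ : ℂ) • G.momentum B)) where
  re_inner f := by
    obtain ⟨h, F, H, K⟩ := f.2
    have h1 := setIntegral_Omega H
    have h2 := K.norm_sq_eq hB
    rw [integral_const_mul] at h1
    have h3 : (inner ℂ h (f : G.L2)).re = ∫ x in G.Omega, (inner ℂ (h x) ((f : G.L2) x)).re := by
      rw [L2.inner_def]
      exact (integral_re (L2.integrable_inner (𝕜 := ℂ) h (f : G.L2))).symm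
    rw [generator_apply κ f H, inner_smul_left, map_neg, Complex.conj_ofReal, neg_mul,
      Complex.neg_re, Complex.re_ofReal_mul, h3]
    have h4 : ∫ x in G.Omega, (inner ℂ (h x) ((f : G.L2) x)).re = 0 := by linarith
    rw [h4, mul_zero, neg_zero]
  surjective _ hs g := generator_surjective hB hκ hs g

/-! ### Monotone mass on half-lines, and the semigroup law. -/

variable (G) in
/-- Restriction to `E ∩ Ω`. -/
def restr (E : Set ℝ) : G.L2 →L[ℂ] Lp ℂ 2 ((volume.restrict G.Omega).restrict E) :=
  LpToLpRestrictCLM ℝ ℂ ℂ (volume.restrict G.Omega) 2 E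

theorem restr_ae (E : Set ℝ) (f : G.L2) :
    G.restr E f =ᵐ[(volume.restrict G.Omega).restrict E] f :=
  LpToLpRestrictCLM_coeFn ℂ E f

theorem restr_eq_zero_iff {E : Set ℝ} (hE : MeasurableSet E) (f : G.L2) :
    G.restr E f = 0 ↔ ∀ᵐ x ∂volume.restrict G.Omega, x ∈ E → f x = 0 := by
  rw [Lp.eq_zero_iff_ae_eq_zero, ← ae_restrict_iff' hE]
  exact ⟨fun h => (restr_ae E f).symm.trans h, fun h => (restr_ae E f).trans h⟩

theorem two_mul_re_inner_restr {E : Set ℝ} (hE : MeasurableSet E) (f h : G.L2) :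
    2 * (inner ℂ (G.restr E h) (G.restr E f)).re
      = ∫ x in E ∩ G.Omega, 2 * (inner ℂ (h x) (f x)).re := by
  rw [L2.inner_def, integral_const_mul, ← Measure.restrict_restrict hE]
  congr 1
  refine (integral_re (L2.integrable_inner (𝕜 := ℂ) (G.restr E h) (G.restr E f))).symm.trans ?_
  refine integral_congr_ae ?_
  filter_upwards [restr_ae E f, restr_ae E h] with x h1 h2
  rw [h1, h2]
  rfl

/-- If the flux out of `E` is nonnegative, the norm on `E` decreases along the group. -/
theorem norm_restr_apply_le (hB : B ∈ Matrix.unitaryGroup (Fin 2) ℂ) {κ : ℝ} (hκ : 0 < κ)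
    {U : ℝ → G.L2 →L[ℂ] G.L2} (hU : IsUnitaryGroupOf ((κ : ℂ) • G.momentum B) U) {E : Set ℝ}
    (hE : ∀ f h F, G.IsRep f h F → G.BoundaryCondition B F →
      0 ≤ 2 * (inner ℂ (G.restr E h) (G.restr E f)).re) {t : ℝ} (ht : 0 ≤ t) (f : G.L2) :
    ‖G.restr E (U t f)‖ ≤ ‖G.restr E f‖ := by
  have hD := isSkewGenerator (G := G) hB hκ
  have dom : ∀ f ∈ ((κ : ℂ) • G.momentum B).domain, ‖G.restr E (U t f)‖ ≤ ‖G.restr E f‖ := by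
    intro f hf
    -- The derivative is `-κ/(2π)` times the flux in `hE`, taken at `U s f`, which is again in the
    -- domain.
    have hd : ∀ s, ∃ r ≤ 0, HasDerivAt (fun s => ‖G.restr E (U s f)‖ ^ 2) r s := by
      intro s
      have h1 := hU.hasDerivAt_apply s ⟨f, hf⟩
      have h2 := hasDerivAt_norm_sq
        (((G.restr E).restrictScalars ℝ).hasFDerivAt.comp_hasDerivAt s h1)
      refine ⟨_, ?_, h2⟩
      obtain ⟨h, F, H, K⟩ := hU.apply_mem_domain s ⟨f, hf⟩
      have h3 := generator_apply κ ⟨U s f, hU.apply_mem_domain s ⟨f, hf⟩⟩ H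
      rw [LinearPMap.smul_apply] at h3
      rw [h3]
      simp only [Function.comp, ContinuousLinearMap.coe_restrictScalars', map_smul]
      have h4 := hE _ _ _ H K
      rw [inner_smul_left, map_neg, Complex.conj_ofReal, neg_mul, Complex.neg_re,
        Complex.re_ofReal_mul]
      have h5 : 0 ≤ κ / (2 * Real.pi) := by positivity
      nlinarith [mul_nonneg h5 h4]
    choose r hr hd using hd
    have hanti : Antitone fun s => ‖G.restr E (U s f)‖ ^ 2 :=
      antitone_of_hasDerivAt_nonpos hd hr
    have h := hanti ht
    simp only [hU.map_zero, one_apply_eq_self] at h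
    exact le_of_sq_le_sq h (norm_nonneg _)
  have hcl : IsClosed {f | ‖G.restr E (U t f)‖ ≤ ‖G.restr E f‖} :=
    isClosed_le ((G.restr E).continuous.comp (U t).continuous).norm (G.restr E).continuous.norm
  exact closure_minimal dom hcl (hD.mem_closure_domain f)

theorem P0_ae (f : G.L2) : G.P0 f =ᵐ[volume.restrict G.Omega] G.I0.indicator f := G.cutoff_ae f

theorem P0_P0 (f : G.L2) : G.P0 (G.P0 f) = G.P0 f := G.cutoff_cutoff f

theorem restr_a_P0 (f : G.L2) : G.restr (Iio G.a) (G.P0 f) = 0 := by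
  rw [restr_eq_zero_iff measurableSet_Iio]
  filter_upwards [P0_ae f] with x hx hm
  rw [hx, indicator_of_notMem (disjoint_left.mp disjoint_Iio_I0 hm)]

theorem restr_c_sub_P0 {f : G.L2} (hf : G.restr (Iio G.a) f = 0) :
    G.restr (Iio G.c) (f - G.P0 f) = 0 := by
  rw [restr_eq_zero_iff measurableSet_Iio] at hf ⊢
  filter_upwards [hf, P0_ae f, Lp.coeFn_sub f (G.P0 f), ae_restrict_mem measurableSet_Omega]
    with x h1 h2 h3 h4 hm
  rw [h3, Pi.sub_apply, h2]
  have h5 : x ∈ Iio G.a ∪ G.I0 := Iio_c_inter_Omega ▸ ⟨hm, h4⟩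
  rcases h5 with h5 | h5
  · rw [indicator_of_notMem (disjoint_left.mp disjoint_Iio_I0 h5), h1 h5, sub_zero]
  · rw [indicator_of_mem h5, sub_self]

theorem P0_eq_zero {f : G.L2} (hf : G.restr (Iio G.c) f = 0) : G.P0 f = 0 := by
  rw [restr_eq_zero_iff measurableSet_Iio] at hf
  rw [Lp.eq_zero_iff_ae_eq_zero]
  filter_upwards [hf, P0_ae f] with x h1 h2
  rw [h2, Pi.zero_apply]
  by_cases hx : x ∈ G.I0
  · rw [indicator_of_mem hx, h1 hx.2]
  · rw [indicator_of_notMem hx]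

/-- The compressions of the group multiply for nonnegative times. -/
theorem P0_apply_P0_apply_P0 (hB : B ∈ Matrix.unitaryGroup (Fin 2) ℂ) {κ : ℝ} (hκ : 0 < κ)
    {U : ℝ → G.L2 →L[ℂ] G.L2} (hU : IsUnitaryGroupOf ((κ : ℂ) • G.momentum B) U) {t s : ℝ}
    (ht : 0 ≤ t) (hs : 0 ≤ s) (f : G.L2) :
    G.P0 (U t (G.P0 (U s (G.P0 f)))) = G.P0 (U (t + s) (G.P0 f)) := by
  -- The mass on `I₋` starts at zero and cannot increase.
  have ha : G.restr (Iio G.a) (U s (G.P0 f)) = 0 := by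
    have h := norm_restr_apply_le hB hκ hU (E := Iio G.a) (fun f h F H _ => by
      rw [two_mul_re_inner_restr measurableSet_Iio, Iio_a_inter_Omega, H.setIntegral_left]
      positivity) hs (G.P0 f)
    rw [restr_a_P0, norm_zero] at h
    exact norm_le_zero_iff.mp h
  -- By `ha` the vector moved by `U t` is supported on `I₊`. Its mass on `I₋ ∪ I₀` starts at zero
  -- and stays zero.
  have hc : G.restr (Iio G.c) (U t (U s (G.P0 f) - G.P0 (U s (G.P0 f)))) = 0 := by
    have h := norm_restr_apply_le hB hκ hU (E := Iio G.c) (fun f h F H K => by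
      rw [two_mul_re_inner_restr measurableSet_Iio, setIntegral_Iio_c H]
      have h1 := K.norm_sq_eq hB
      nlinarith [sq_nonneg ‖F G.d‖]) ht (U s (G.P0 f) - G.P0 (U s (G.P0 f)))
    rw [restr_c_sub_P0 ha, norm_zero] at h
    exact norm_le_zero_iff.mp h
  have h := P0_eq_zero hc
  rw [map_sub, map_sub, sub_eq_zero] at h
  rw [← h, hU.map_add, mul_apply_eq_comp]

theorem compression_apply (T : G.L2 →L[ℂ] G.L2) (f : G.L2I0) :
    (G.compression T f : G.L2) = G.P0 (T (G.P0 f)) := rfl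

theorem norm_P0_le (f : G.L2) : ‖G.P0 f‖ ≤ ‖f‖ := G.norm_cutoff_le f

theorem P0_coe (f : G.L2I0) : G.P0 (f : G.L2) = f := f.2

theorem isContractionSemigroup_compression (hB : B ∈ Matrix.unitaryGroup (Fin 2) ℂ) {κ : ℝ}
    (hκ : 0 < κ) {U : ℝ → G.L2 →L[ℂ] G.L2}
    (hU : IsUnitaryGroupOf ((κ : ℂ) • G.momentum B) U) :
    IsContractionSemigroup fun t : ℝ≥0 => G.compression (U t) where
  norm_le_one t := by
    refine ContinuousLinearMap.opNorm_le_bound _ zero_le_one fun f => ?_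
    rw [one_mul]
    change ‖G.P0 (U t (G.P0 f))‖ ≤ ‖(f : G.L2)‖
    refine (norm_P0_le _).trans ?_
    rw [hU.norm_apply]
    exact norm_P0_le _
  map_add t s := by
    ext1 f
    refine Subtype.ext ?_
    rw [mul_apply_eq_comp, compression_apply, compression_apply, compression_apply, P0_P0,
      NNReal.coe_add]
    exact P0_apply_P0_apply_P0 hB hκ hU t.2 s.2 f
  map_zero := by
    ext1 f
    refine Subtype.ext ?_
    rw [compression_apply, NNReal.coe_zero, hU.map_zero, one_apply_eq_self, P0_P0, P0_coe,
      one_apply_eq_self]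
  continuous f := by
    refine Continuous.subtype_mk ?_ _
    exact G.P0.continuous.comp ((hU.continuous (G.P0 f)).comp NNReal.continuous_coe)

end Obstacles

end LaxPhillips

end

theorem theorem6p11 (G : LaxPhillips.Obstacles) (B : Matrix (Fin 2) (Fin 2) ℂ)
    (hB : B ∈ Matrix.unitaryGroup (Fin 2) ℂ) (κ : ℝ) (hκ : 0 < κ) :
    (∃! U : ℝ → G.L2 →L[ℂ] G.L2,
      LaxPhillips.IsUnitaryGroupOf ((κ : ℂ) • G.momentum B) U) ∧
    ∀ U : ℝ → G.L2 →L[ℂ] G.L2, LaxPhillips.IsUnitaryGroupOf ((κ : ℂ) • G.momentum B) U →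
      LaxPhillips.IsContractionSemigroup (fun t : ℝ≥0 => G.compression (U t)) ∧
      G.P0 ∘L U 0 ∘L G.P0 = G.P0 := by
  refine ⟨LaxPhillips.existsUnique_isUnitaryGroupOf
    (LaxPhillips.Obstacles.isSkewGenerator hB hκ), fun U hU =>
    ⟨LaxPhillips.Obstacles.isContractionSemigroup_compression hB hκ hU, ?_⟩⟩
  ext1 f
  rw [hU.map_zero]
  exact LaxPhillips.Obstacles.P0_P0 f
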